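/- Let $M$ be a smooth closed manifold (compact, without boundary) of dimension $n\ge 1$. Let $\mathcal S$ be the Fréchet space of smooth symmetric $(0,2)$-tensor fields on $M$ with the $C^\infty$ topology, and let $\mathcal M\subset\mathcal S$ be the open set of smooth Riemannian metrics, with the $L^2$ Riemannian metric $$(h,k)_g=\int_M \operatorname{tr}(g^{-1}h\,g^{-1}k)\,d\mu_g ,\qquad g\in\mathcal M,\ h,k\in T_g\mathcal M=\mathcal S,$$ where $\mu_g=\sqrt{\det g}\,dx^1\cdots dx^n$ in local coordinates. For a symmetric tensor field $\tilde g$ that is only measurable and positive semidefinite almost everywhere, $\mu_{\tilde g}$ is defined by the same formula and $\operatorname{Vol}(M,\tilde g)=\mu_{\tilde g}(M)$. Let $\mathcal P$ be the set of smooth positive functions on $M$. Fix $g\in\mathcal M$ and give the orbit $\mathcal P\cdot g=\{\rho g:\rho\in\mathcal P\}$ the distance $d_{\mathcal P\cdot g}$ induced on it as a submanifold of $\mathcal M$: the infimum of the lengths of piecewise $C^1$ paths in $\mathcal P\cdot g$. Let $$\overline U=\{\lambda\in L^2(M,\mu_g):\lambda\ge -\tfrac4n \text{ a.e.}\},\qquad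 \psi(\lambda)=\Bigl(1+\frac n4\lambda\Bigr)^{4/n}g ,$$ and identify tensor fields that agree $\mu_g$-almost everywhere. (1) If $\rho$ is measurable and $\rho\ge0$ a.e., then $\operatorname{Vol}(M,\rho g)=\int_M\rho^{n/2}\,d\mu_g$. Hence $$Y_g:=\{\rho g:\rho\text{ measurable},\ \rho\ge 0\text{ a.e.},\ \operatorname{Vol}(M,\rho g)<\infty\}=\Bigl\{\rho g:\rho\text{ measurable},\ \rho\ge 0\text{ a.e.},\ \int_M\rho^{n/2}\,d\mu_g<\infty\Bigr\}.$$ (2) $\psi$ is a bijection from $\overline U$ onto $Y_g$. There is a bijection from the completion $\overline{\mathcal P\cdot g}$ of $(\mathcal P\cdot g,d_{\mathcal P\cdot g})$ onto $Y_g$ that is the inclusion on $\mathcal P\cdot g$, and under this identification the distance of the completion is $$d_{\overline{\mathcal P\cdot g}}(\rho_1g,\rho_2g)=\sqrt n\,\bigl\|\psi^{-1}(\rho_2g)-\psi^{-1}(\rho_1g)\bigr\|_{L^2(M,\mu_g)} .$$ (3) If $n=1$ (in particular if $M=S^1$ and $g$ is its standard metric), let $d$ be the distance on the whole of $\mathcal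 M$ induced by the $L^2$ metric. Then there is a bijection from the completion of $(\mathcal M,d)$ onto $$\{\rho g:\rho\text{ measurable},\ \rho\ge0\text{ a.e.},\ \sqrt\rho\in L^1(M,\mu_g)\}$$ that is the inclusion on $\mathcal M$, and under it the distance of the completion is $\|\psi^{-1}(\rho_2g)-\psi^{-1}(\rho_1g)\|_{L^2(M,\mu_g)}$. -/

import Mathlib

open Set Filter Topology MeasureTheory Manifold
open scoped ContDiff

noncomputable section

/-! ### Tensor fields and the space of smooth metrics -/

/-- Arbitrary `(0,2)`-tensor fields on `M` (no regularity, no symmetry). -/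
abbrev TensorField (n : ℕ) (M : Type*) [TopologicalSpace M]
    [ChartedSpace (EuclideanSpace ℝ (Fin n)) M] [IsManifold (𝓡 n) ∞ M] : Type _ :=
  ∀ x : M, TangentSpace (𝓡 n) x →L[ℝ] TangentSpace (𝓡 n) x →L[ℝ] ℝ

section

variable {n : ℕ} {M : Type*} [TopologicalSpace M]
  [ChartedSpace (EuclideanSpace ℝ (Fin n)) M] [IsManifold (𝓡 n) ∞ M]

set_option synthInstance.maxHeartbeats 400000 in
instance cotangent_isTopologicalAddGroup (x : M) :
    IsTopologicalAddGroup (TangentSpace (𝓡 n) x →L[ℝ] ℝ) := inferInstance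

set_option synthInstance.maxHeartbeats 400000 in
instance cotangent_continuousAdd (x : M) :
    ContinuousAdd (TangentSpace (𝓡 n) x →L[ℝ] ℝ) := inferInstance

end

/-- The smooth symmetric `(0,2)`-tensor fields on `M`, as a subspace of the smooth sections of the
bundle of bilinear forms on `TM`. -/
def symTensorSubmodule (n : ℕ) (M : Type*) [TopologicalSpace M]
    [ChartedSpace (EuclideanSpace ℝ (Fin n)) M] [IsManifold (𝓡 n) ∞ M] :
    Submodule ℝ (ContMDiffSection (𝓡 n)
      (EuclideanSpace ℝ (Fin n) →L[ℝ] EuclideanSpace ℝ (Fin n) →L[ℝ] ℝ) ∞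
      (fun x : M => TangentSpace (𝓡 n) x →L[ℝ] TangentSpace (𝓡 n) x →L[ℝ] ℝ)) where
  carrier := {h | ∀ (x : M) (v w : TangentSpace (𝓡 n) x), h x v w = h x w v}
  zero_mem' := fun _ _ _ => rfl
  add_mem' := fun {h k} hh hk x v w => by
    have h1 := hh x v w
    have h2 := hk x v w
    show h x v w + k x v w = h x w v + k x w v
    rw [h1, h2]
  smul_mem' := fun c h hh x v w => by
    have h1 := hh x v w
    show c • h x v w = c • h x w v
    rw [h1]

/-- The vector space of smooth symmetric `(0,2)`-tensor fields on `M`. -/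
def SymTensor (n : ℕ) (M : Type*) [TopologicalSpace M]
    [ChartedSpace (EuclideanSpace ℝ (Fin n)) M] [IsManifold (𝓡 n) ∞ M] : Type _ :=
  symTensorSubmodule n M

section

variable {n : ℕ} {M : Type*} [TopologicalSpace M]
  [ChartedSpace (EuclideanSpace ℝ (Fin n)) M] [IsManifold (𝓡 n) ∞ M]

instance : AddCommGroup (SymTensor n M) := inferInstanceAs (AddCommGroup (symTensorSubmodule n M))

instance : Module ℝ (SymTensor n M) := inferInstanceAs (Module ℝ (symTensorSubmodule n M))

/-- The underlying tensor field of a smooth symmetric tensor. -/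
def SymTensor.field (h : SymTensor n M) : TensorField n M := fun x => h.1 x

lemma SymTensor.field_add (h k : SymTensor n M) (x : M) :
    (h + k).field x = h.field x + k.field x := rfl

lemma SymTensor.field_neg (h : SymTensor n M) (x : M) :
    (-h).field x = -h.field x := rfl

lemma SymTensor.field_smul (c : ℝ) (h : SymTensor n M) (x : M) :
    (c • h).field x = c • h.field x := rfl

variable (n M) in
/-- The set of smooth Riemannian metrics: the positive definite elements of `SymTensor n M`. -/
def riemMetrics : Set (SymTensor n M) :=
  {g | ∀ (x : M) (v : TangentSpace (𝓡 n) x), v ≠ 0 → 0 < g.field x v v}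

/-- The conformal orbit of `g`: all `ρ g` with `ρ` a smooth positive function. -/
def conformalOrbit (g : SymTensor n M) : Set (SymTensor n M) :=
  {h | ∃ ρ : M → ℝ, ContMDiff (𝓡 n) 𝓘(ℝ, ℝ) ∞ ρ ∧ (∀ x, 0 < ρ x) ∧
    ∀ x, h.field x = ρ x • g.field x}

/-! ### Coordinate expressions, Riemannian volume, `L²` metric -/

/-- The `i`-th coordinate vector field of the chart `e`, at the point with coordinates `u`. -/
def coordVector (e : OpenPartialHomeomorph M (EuclideanSpace ℝ (Fin n))) (i : Fin n)
    (u : EuclideanSpace ℝ (Fin n)) : TangentSpace (𝓡 n) (e.symm u) :=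
  mfderiv (𝓡 n) (𝓡 n) e.symm u (EuclideanSpace.single i (1 : ℝ))

/-- The coefficients `h_ij` of a tensor field in the chart `e`, as functions of the coordinates
(meaningful on `e.target`). -/
def coeff (e : OpenPartialHomeomorph M (EuclideanSpace ℝ (Fin n))) (h : TensorField n M)
    (i j : Fin n) (u : EuclideanSpace ℝ (Fin n)) : ℝ :=
  h (e.symm u) (coordVector e i u) (coordVector e j u)

/-- The measure `√(det (h_ij)) dx¹ ⋯ dxⁿ` on the domain of the chart `e`, extended by zero to `M`. -/
def chartVolume [MeasurableSpace M] (e : OpenPartialHomeomorph M (EuclideanSpace ℝ (Fin n)))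
    (h : TensorField n M) : Measure M :=
  Measure.map e.symm ((volume.restrict e.target).withDensity
    (fun u => ENNReal.ofReal (√(Matrix.det (Matrix.of (fun i j => coeff e h i j u))))))

/-- The measure `μ_h` on `M` given by `√(det (h_ij)) dx¹ ⋯ dxⁿ` in every chart of the atlas: the
least measure that dominates all these local measures. As these agree on overlaps of charts (change
of variables), its restriction to each chart domain is the local one. -/
def volMeasure [MeasurableSpace M] (h : TensorField n M) : Measure M :=
  ⨆ e : atlas (EuclideanSpace ℝ (Fin n)) M, chartVolume e.1 h

/-- The matrix of a bilinear form on `T_x M` in the standard basis of `T_x M = ℝⁿ`. -/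
def formMatrix (x : M) (b : TangentSpace (𝓡 n) x →L[ℝ] TangentSpace (𝓡 n) x →L[ℝ] ℝ) :
    Matrix (Fin n) (Fin n) ℝ :=
  Matrix.of fun i j =>
    b (EuclideanSpace.single i (1 : ℝ) : EuclideanSpace ℝ (Fin n))
      (EuclideanSpace.single j (1 : ℝ) : EuclideanSpace ℝ (Fin n))

/-- `tr_g (h k) = tr (g⁻¹ h g⁻¹ k)` at the point `x` (independent of the basis of `T_x M`). -/
def traceProd (g h k : TensorField n M) (x : M) : ℝ :=
  Matrix.trace ((formMatrix x (g x))⁻¹ * formMatrix x (h x) *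
    (formMatrix x (g x))⁻¹ * formMatrix x (k x))

/-- The `L²` metric `(h, k)_g = ∫_M tr_g (h k) dμ_g`. -/
def l2Metric [MeasurableSpace M] (g h k : SymTensor n M) : ℝ :=
  ∫ x, traceProd g.field h.field k.field x ∂(volMeasure g.field)

/-! ### Piecewise `C¹` paths, their lengths, and the induced distance -/

/-- Convergence in the Fréchet (`C^∞`) topology of the space of smooth symmetric tensors: in every
chart, all derivatives of all coefficients converge locally uniformly. -/
def TendstoSmooth {ι : Type*} (f : ι → SymTensor n M) (l : Filter ι) (h : SymTensor n M) : Prop :=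
  ∀ e ∈ atlas (EuclideanSpace ℝ (Fin n)) M, ∀ (k : ℕ) (i j : Fin n),
    TendstoLocallyUniformlyOn
      (fun s => iteratedFDeriv ℝ k (coeff e (f s).field i j))
      (iteratedFDeriv ℝ k (coeff e h.field i j)) l e.target

/-- A `C¹` path `[a, b] → N` from `x` to `y`, where `N` is a set of smooth symmetric tensors and
`C¹` refers to the Fréchet topology; `vel` is the derivative (one-sided at `a` and `b`). -/
structure C1Path (N : Set (SymTensor n M)) (x y : SymTensor n M) where
  a : ℝ
  b : ℝ
  a_le_b : a ≤ b
  path : ℝ → SymTensor n M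
  vel : ℝ → SymTensor n M
  source : path a = x
  target : path b = y
  mem : ∀ t ∈ Icc a b, path t ∈ N
  hasDeriv : ∀ t ∈ Icc a b,
    TendstoSmooth (fun s => (s - t)⁻¹ • (path s - path t)) (𝓝[Icc a b \ {t}] t) (vel t)
  cont_vel : ∀ t ∈ Icc a b, TendstoSmooth vel (𝓝[Icc a b] t) (vel t)

/-- The length `∫_a^b √((α'(t), α'(t))_{α(t)}) dt`. -/
def C1Path.length [MeasurableSpace M] {N : Set (SymTensor n M)} {x y : SymTensor n M}
    (α : C1Path N x y) : ℝ :=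
  ∫ t in α.a..α.b, √(l2Metric (α.path t) (α.vel t) (α.vel t))

/-- Piecewise `C¹` paths in `N`: finite concatenations of `C¹` paths. -/
inductive PiecewiseC1Path (N : Set (SymTensor n M)) : SymTensor n M → SymTensor n M → Type _
  | single {x y : SymTensor n M} (α : C1Path N x y) : PiecewiseC1Path N x y
  | concat {x y z : SymTensor n M} (α : PiecewiseC1Path N x y) (β : PiecewiseC1Path N y z) :
      PiecewiseC1Path N x z

/-- The length of a piecewise `C¹` path. -/
def PiecewiseC1Path.length [MeasurableSpace M] {N : Set (SymTensor n M)} :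
    {x y : SymTensor n M} → PiecewiseC1Path N x y → ℝ
  | _, _, .single α => α.length
  | _, _, .concat α β => α.length + β.length

/-- The distance function induced by the `L²` metric on a set `N` of smooth metrics: the infimum of
the lengths of piecewise `C¹` paths in `N`. -/
def pathDist [MeasurableSpace M] (N : Set (SymTensor n M)) (x y : SymTensor n M) : ℝ :=
  ⨅ α : PiecewiseC1Path N x y, α.length

/-! ### The distance functions are pseudometrics -/

lemma coeff_neg (e : OpenPartialHomeomorph M (EuclideanSpace ℝ (Fin n))) (h : SymTensor n M)
    (i j : Fin n) : coeff e (-h).field i j = -coeff e h.field i j := rfl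

lemma TendstoSmooth.neg {ι : Type*} {f : ι → SymTensor n M} {l : Filter ι} {h : SymTensor n M}
    (hf : TendstoSmooth f l h) : TendstoSmooth (fun s => -f s) l (-h) := by
  intro e he k i j
  have h1 := hf e he k i j
  simp only [coeff_neg, iteratedFDeriv_neg]
  rw [Metric.tendstoLocallyUniformlyOn_iff] at h1 ⊢
  intro ε hε x hx
  obtain ⟨t, ht, h2⟩ := h1 ε hε x hx
  refine ⟨t, ht, h2.mono fun s hs y hy => ?_⟩
  have h3 := hs y hy
  rwa [Pi.neg_apply, Pi.neg_apply, dist_neg_neg]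

lemma TendstoSmooth.comp {ι κ : Type*} {f : ι → SymTensor n M} {l : Filter ι} {h : SymTensor n M}
    (hf : TendstoSmooth f l h) {l' : Filter κ} {φ : κ → ι} (hφ : Tendsto φ l' l) :
    TendstoSmooth (fun s => f (φ s)) l' h := by
  intro e he k i j u hu x hx
  obtain ⟨t, ht, h2⟩ := hf e he k i j u hu x hx
  exact ⟨t, ht, hφ.eventually h2⟩

lemma TendstoSmooth.of_eventually_eq {ι : Type*} {f : ι → SymTensor n M} {l : Filter ι}
    {h : SymTensor n M} (hf : ∀ᶠ s in l, f s = h) : TendstoSmooth f l h := by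
  intro e he k i j u hu x hx
  refine ⟨univ, univ_mem, hf.mono fun s hs y _ => ?_⟩
  simp only [hs]
  exact refl_mem_uniformity hu

lemma traceProd_neg_neg (g h k : SymTensor n M) (x : M) :
    traceProd g.field (-h).field (-k).field x = traceProd g.field h.field k.field x := by
  have hn : ∀ h : SymTensor n M, formMatrix x ((-h).field x) = -formMatrix x (h.field x) :=
    fun h => rfl
  simp only [traceProd, hn, mul_neg, neg_mul, neg_neg]

/-- The reversed path. -/
def C1Path.reverse {N : Set (SymTensor n M)} {x y : SymTensor n M} (α : C1Path N x y) :
    C1Path N y x where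
  a := -α.b
  b := -α.a
  a_le_b := neg_le_neg α.a_le_b
  path := fun t => α.path (-t)
  vel := fun t => -α.vel (-t)
  source := by simpa using α.target
  target := by simpa using α.source
  mem := fun t ht => α.mem (-t) ⟨by linarith [ht.2], by linarith [ht.1]⟩
  hasDeriv := fun t ht => by
    have h1 := α.hasDeriv (-t) ⟨by linarith [ht.2], by linarith [ht.1]⟩
    have h2 : Tendsto (fun s : ℝ => -s) (𝓝[Icc (-α.b) (-α.a) \ {t}] t)
        (𝓝[Icc α.a α.b \ {-t}] (-t)) := by
      refine tendsto_nhdsWithin_of_tendsto_nhds_of_eventually_within _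
        ((continuous_neg.tendsto t).mono_left nhdsWithin_le_nhds) ?_
      filter_upwards [self_mem_nhdsWithin] with s hs
      refine ⟨⟨by linarith [hs.1.2], by linarith [hs.1.1]⟩, fun h => hs.2 ?_⟩
      exact neg_injective h
    have h3 := (h1.comp h2).neg
    have h4 : (fun s : ℝ => -((-s - -t)⁻¹ • (α.path (-s) - α.path (-t)))) =
        fun s : ℝ => (s - t)⁻¹ • (α.path (-s) - α.path (-t)) := by
      funext s
      rw [← neg_smul, ← inv_neg]
      congr 2
      ring
    rwa [h4] at h3
  cont_vel := fun t ht => by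
    have h1 := α.cont_vel (-t) ⟨by linarith [ht.2], by linarith [ht.1]⟩
    have h2 : Tendsto (fun s : ℝ => -s) (𝓝[Icc (-α.b) (-α.a)] t) (𝓝[Icc α.a α.b] (-t)) := by
      refine tendsto_nhdsWithin_of_tendsto_nhds_of_eventually_within _
        ((continuous_neg.tendsto t).mono_left nhdsWithin_le_nhds) ?_
      filter_upwards [self_mem_nhdsWithin] with s hs
      exact ⟨by linarith [hs.2], by linarith [hs.1]⟩
    exact (h1.comp h2).neg

lemma C1Path.length_reverse [MeasurableSpace M] {N : Set (SymTensor n M)} {x y : SymTensor n M}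
    (α : C1Path N x y) : α.reverse.length = α.length := by
  have h : ∀ t, l2Metric (α.path (-t)) (-α.vel (-t)) (-α.vel (-t)) =
      l2Metric (α.path (-t)) (α.vel (-t)) (α.vel (-t)) := fun t => by
    simp only [l2Metric, traceProd_neg_neg]
  simp only [C1Path.length, C1Path.reverse, h]
  rw [intervalIntegral.integral_comp_neg
    (fun t => √(l2Metric (α.path t) (α.vel t) (α.vel t)))]
  simp

lemma C1Path.length_nonneg [MeasurableSpace M] {N : Set (SymTensor n M)} {x y : SymTensor n M}
    (α : C1Path N x y) : 0 ≤ α.length :=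
  intervalIntegral.integral_nonneg α.a_le_b fun _ _ => Real.sqrt_nonneg _

lemma PiecewiseC1Path.length_nonneg [MeasurableSpace M] {N : Set (SymTensor n M)}
    {x y : SymTensor n M} (α : PiecewiseC1Path N x y) : 0 ≤ α.length := by
  induction α with
  | single α => exact α.length_nonneg
  | concat α β ihα ihβ => exact add_nonneg ihα ihβ

lemma PiecewiseC1Path.exists_reverse [MeasurableSpace M] {N : Set (SymTensor n M)}
    {x y : SymTensor n M} (α : PiecewiseC1Path N x y) :
    ∃ β : PiecewiseC1Path N y x, β.length = α.length := by
  induction α with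
  | single α => exact ⟨.single α.reverse, α.length_reverse⟩
  | concat α β ihα ihβ =>
    obtain ⟨α', hα⟩ := ihα
    obtain ⟨β', hβ⟩ := ihβ
    refine ⟨.concat β' α', ?_⟩
    show β'.length + α'.length = α.length + β.length
    rw [hα, hβ, add_comm]

/-- The straight path between two points of a convex set. -/
def C1Path.segment {N : Set (SymTensor n M)} (hN : Convex ℝ N) {x y : SymTensor n M}
    (hx : x ∈ N) (hy : y ∈ N) : C1Path N x y where
  a := 0
  b := 1
  a_le_b := zero_le_one
  path := fun t => x + t • (y - x)
  vel := fun _ => y - x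
  source := by simp
  target := by simp
  mem := fun t ht => by
    have h : x + t • (y - x) = (1 - t) • x + t • y := by
      rw [smul_sub, sub_smul, one_smul]; abel
    rw [h]
    exact hN hx hy (by linarith [ht.2]) ht.1 (by ring)
  hasDeriv := fun t ht => by
    refine TendstoSmooth.of_eventually_eq ?_
    filter_upwards [self_mem_nhdsWithin] with s hs
    have h : s - t ≠ 0 := sub_ne_zero.2 fun h => hs.2 h
    rw [add_sub_add_left_eq_sub, ← sub_smul, smul_smul, inv_mul_cancel₀ h, one_smul]
  cont_vel := fun t ht => TendstoSmooth.of_eventually_eq (Eventually.of_forall fun _ => rfl)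

lemma pathDist_bddBelow [MeasurableSpace M] (N : Set (SymTensor n M)) (x y : SymTensor n M) :
    BddBelow (range fun α : PiecewiseC1Path N x y => α.length) :=
  ⟨0, by rintro _ ⟨α, rfl⟩; exact α.length_nonneg⟩

lemma pathDist_comm_le [MeasurableSpace M] {N : Set (SymTensor n M)} (hN : Convex ℝ N)
    {x y : SymTensor n M} (hx : x ∈ N) (hy : y ∈ N) : pathDist N x y ≤ pathDist N y x := by
  have : Nonempty (PiecewiseC1Path N y x) := ⟨.single (C1Path.segment hN hy hx)⟩
  refine le_ciInf fun α => ?_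
  obtain ⟨β, hβ⟩ := α.exists_reverse
  rw [← hβ]
  exact ciInf_le (pathDist_bddBelow N x y) β

/-- The pseudometric induced by the `L²` metric on a convex set of smooth metrics. -/
@[reducible] def pathPseudoMetricSpace [MeasurableSpace M] (N : Set (SymTensor n M))
    (hN : Convex ℝ N) : PseudoMetricSpace N where
  dist x y := pathDist N x.1 y.1
  dist_self x := by
    refine le_antisymm ?_ (Real.iInf_nonneg fun α => α.length_nonneg)
    let α : C1Path N x.1 x.1 :=
      { C1Path.segment hN x.2 x.2 with
        b := 0
        a_le_b := le_rfl
        target := by simp [C1Path.segment]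
        mem := fun t ht => (C1Path.segment hN x.2 x.2).mem t ⟨ht.1, ht.2.trans zero_le_one⟩
        hasDeriv := fun t ht => by
          refine TendstoSmooth.of_eventually_eq ?_
          filter_upwards [self_mem_nhdsWithin] with s hs
          simp [C1Path.segment]
        cont_vel := fun t ht =>
          TendstoSmooth.of_eventually_eq (Eventually.of_forall fun _ => rfl) }
    refine (ciInf_le (pathDist_bddBelow N x.1 x.1) (.single α)).trans_eq ?_
    show α.length = 0
    simp [C1Path.length, α, C1Path.segment]
  dist_comm x y :=
    le_antisymm (pathDist_comm_le hN x.2 y.2) (pathDist_comm_le hN y.2 x.2)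
  dist_triangle x y z := by
    have h1 : Nonempty (PiecewiseC1Path N x.1 y.1) := ⟨.single (C1Path.segment hN x.2 y.2)⟩
    have h2 : Nonempty (PiecewiseC1Path N y.1 z.1) := ⟨.single (C1Path.segment hN y.2 z.2)⟩
    show pathDist N x.1 z.1 ≤ pathDist N x.1 y.1 + pathDist N y.1 z.1
    refine le_ciInf_add_ciInf fun α β => ?_
    exact ciInf_le (pathDist_bddBelow N x.1 z.1) (.concat α β)

lemma convex_riemMetrics : Convex ℝ (riemMetrics n M) := by
  intro g hg h hh a b ha hb hab x v hv
  have h1 := hg x v hv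
  have h2 := hh x v hv
  have h3 : (a • g + b • h).field x v v = a * g.field x v v + b * h.field x v v := rfl
  rw [h3]
  rcases ha.eq_or_lt with rfl | ha'
  · have : b = 1 := by linarith
    subst this
    linarith
  · have := mul_pos ha' h1
    have := mul_nonneg hb h2.le
    linarith

lemma convex_conformalOrbit (g : SymTensor n M) : Convex ℝ (conformalOrbit g) := by
  rintro h ⟨ρ, hρ, hρ0, hh⟩ k ⟨σ, hσ, hσ0, hk⟩ a b ha hb hab
  refine ⟨fun x => a * ρ x + b * σ x,
    (contMDiff_const.mul hρ).add (contMDiff_const.mul hσ), fun x => ?_, fun x => ?_⟩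
  · have h1 := hρ0 x
    have h2 := hσ0 x
    rcases ha.eq_or_lt with rfl | ha'
    · have : b = 1 := by linarith
      subst this
      simpa using h2
    · have := mul_pos ha' h1
      have := mul_nonneg hb h2.le
      linarith
  · rw [SymTensor.field_add, SymTensor.field_smul, SymTensor.field_smul, hh, hk, smul_smul,
      smul_smul, add_smul]

variable (n M) in
/-- The manifold of smooth metrics on `M`, with the distance `d` of the `L²` metric. -/
def MetricManifold : Type _ := riemMetrics n M

/-- The conformal orbit of `g`, with the distance induced on it as a submanifold of the manifold of
metrics (infimum of lengths of paths that stay in the orbit). -/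
def ConformalOrbit (g : SymTensor n M) : Type _ := conformalOrbit g

instance [MeasurableSpace M] : PseudoMetricSpace (MetricManifold n M) :=
  pathPseudoMetricSpace (riemMetrics n M) convex_riemMetrics

instance [MeasurableSpace M] (g : SymTensor n M) : PseudoMetricSpace (ConformalOrbit g) :=
  pathPseudoMetricSpace (conformalOrbit g) (convex_conformalOrbit g)

/-! ### Tensor fields modulo equality almost everywhere, and the exponential chart -/

/-- Equality of tensor fields `μ_g`-almost everywhere. -/
def aeSetoid [MeasurableSpace M] (g : SymTensor n M) : Setoid (TensorField n M) where
  r h k := ∀ᵐ x ∂(volMeasure g.field), h x = k x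
  iseqv :=
    { refl := fun _ => Eventually.of_forall fun _ => rfl
      symm := fun h => h.mono fun _ hx => hx.symm
      trans := fun h k => by filter_upwards [h, k] with x h1 h2 using h1.trans h2 }

/-- Tensor fields modulo equality `μ_g`-almost everywhere. -/
def AETensorField [MeasurableSpace M] (g : SymTensor n M) : Type _ := Quotient (aeSetoid g)

/-- The class of a tensor field modulo equality almost everywhere. -/
def AETensorField.mk [MeasurableSpace M] (g : SymTensor n M) (h : TensorField n M) :
    AETensorField g := Quotient.mk (aeSetoid g) h

/-- The tensor field `ρ g`. -/
def conf (ρ : M → ℝ) (g : SymTensor n M) : TensorField n M := fun x => ρ x • g.field x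

/-- The (classes of) tensor fields `ρ g` with `ρ` measurable, `ρ ≥ 0` almost everywhere and
`Vol (M, ρ g) < ∞`. -/
def finiteVolumeConformal [MeasurableSpace M] (g : SymTensor n M) : Set (AETensorField g) :=
  {T | ∃ ρ : M → ℝ, AEMeasurable ρ (volMeasure g.field) ∧ (∀ᵐ x ∂(volMeasure g.field), 0 ≤ ρ x) ∧
    volMeasure (conf ρ g) univ < (⊤ : ENNReal) ∧ T = AETensorField.mk g (conf ρ g)}

/-- The (classes of) tensor fields `ρ g` with `ρ` measurable, `ρ ≥ 0` almost everywhere and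
`∫ ρ^(n/2) dμ_g < ∞`. -/
def integrableConformal [MeasurableSpace M] (g : SymTensor n M) : Set (AETensorField g) :=
  {T | ∃ ρ : M → ℝ, AEMeasurable ρ (volMeasure g.field) ∧ (∀ᵐ x ∂(volMeasure g.field), 0 ≤ ρ x) ∧
    ∫⁻ x, ENNReal.ofReal (ρ x ^ ((n : ℝ) / 2)) ∂(volMeasure g.field) < (⊤ : ENNReal) ∧
    T = AETensorField.mk g (conf ρ g)}

/-- The closure of the domain of the exponential chart: `λ ∈ L²(M, μ_g)` with `λ ≥ -4/n` a.e. -/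
def expDomain [MeasurableSpace M] (g : SymTensor n M) : Set (Lp ℝ 2 (volMeasure g.field)) :=
  {lam | ∀ᵐ x ∂(volMeasure g.field), -(4 / (n : ℝ)) ≤ lam x}

/-- The exponential chart `ψ(λ) = (1 + (n/4) λ)^(4/n) g`. -/
def expChart [MeasurableSpace M] (g : SymTensor n M) (lam : Lp ℝ 2 (volMeasure g.field)) :
    AETensorField g :=
  AETensorField.mk g (conf (fun x => (1 + (n : ℝ) / 4 * lam x) ^ (4 / (n : ℝ))) g)

end

end

/-!
The conformal orbit of `g` is flat in the coordinate `ρ ^ (n / 4)`. By the change of variables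
formula the local measures `√(det (h_ij)) dx` agree on overlaps of charts
(`chartVolume_eq_of_subset`), so their supremum restricts to each of them
(`volMeasure_restrict_source`). Since `det (ρ g) = ρ ^ n det g`, this gives
`μ_{ρ g} = ρ ^ (n / 2) μ_g` (`volMeasure_conf`), hence the description of the finite volume
multiples of `g` and the bijectivity of the exponential chart (`bijOn_expChart`). It also shows that
the squared norm of a velocity `σ g` at `ρ g` is `n ∫ (ρ ^ (n / 4 - 1) σ)² dμ_g` (`l2Metric_conf`):
up to the factor `n`, the squared `L²` norm of the derivative of
`ψ⁻¹ (ρ g) = (4 / n) (ρ ^ (n / 4) - 1)`.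

The distance in the orbit is therefore `√n` times the `L²` distance of the coordinates
(`pathDist_conformalOrbit`). It is at least that by Minkowski's integral inequality, applied to the
conformal factors along a `C¹` path, which are jointly continuous in time and space
(`C1Path.sqrt_mul_le_length`). For the other inequality, the segment that is affine in
`ρ ^ (n / 4)` is approximated by inscribed polygons whose sides are straight in the space of
tensors. If the factors at the ends of a side have ratio at most `Q`, then its length exceeds the
distance of the coordinates by a factor of at most `Q ^ |n / 4 - 1|` (`pathDist_le_of_ratio`), and
for polygons with `N` sides `Q → 1` uniformly (`pathDist_le_polygon`). Straight sides avoid the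
verification that a path with values in nonlinear powers is `C¹` in the `C^∞` topology.

The coordinates of smooth metrics are dense in the closed domain of the exponential chart: a
function in the domain is close in `L²` to a continuous one that is `≥ -4 / n`, and this one is
uniformly close to a smooth function with values `> -4 / n` (`expDomain_subset_closure`). The
isometry onto a dense part extends to a bijection from the completion (`exists_completion_bijOn`).
In dimension one every metric is conformal to `g`, so that the space of all metrics is the orbit
(`riemMetrics_one_eq_conformalOrbit`).
-/

noncomputable section

/-! ### Coefficients of tensor fields in charts -/

section coordinates
variable {n : ℕ} {M : Type*} [TopologicalSpace M]
  [ChartedSpace (EuclideanSpace ℝ (Fin n)) M] [IsManifold (𝓡 n) ∞ M]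

lemma contMDiffOn_coordVector {e : OpenPartialHomeomorph M (EuclideanSpace ℝ (Fin n))}
    (he : e ∈ atlas (EuclideanSpace ℝ (Fin n)) M) (i : Fin n) :
    ContMDiffOn (𝓡 n) (𝓡 n).tangent ∞
      (fun u => (⟨e.symm u, coordVector e i u⟩ : TangentBundle (𝓡 n) M)) e.target := by
  have hs : ContMDiffOn (𝓡 n) (𝓡 n) ∞ e.symm e.target :=
    contMDiffOn_symm_of_mem_maximalAtlas (IsManifold.subset_maximalAtlas he)
  have ht := hs.contMDiffOn_tangentMapWithin (m := ∞) (by simp) e.open_target.uniqueMDiffOn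
  have hc : ContMDiff (𝓡 n) (𝓡 n).tangent ∞ (fun u : EuclideanSpace ℝ (Fin n) =>
      (⟨u, EuclideanSpace.single i (1 : ℝ)⟩ : TangentBundle (𝓡 n) (EuclideanSpace ℝ (Fin n)))) := by
    intro u
    refine (Bundle.contMDiffAt_section (E := TangentSpace (𝓡 n)) _).2 ?_
    simp
    exact contMDiffAt_const
  refine (ht.comp hc.contMDiffOn (fun u hu => hu)).congr fun u hu => ?_
  simp only [tangentMapWithin, Function.comp, coordVector]
  rw [mfderivWithin_of_isOpen e.open_target hu]

set_option synthInstance.maxHeartbeats 400000 in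
lemma contDiffOn_coeff {e : OpenPartialHomeomorph M (EuclideanSpace ℝ (Fin n))}
    (he : e ∈ atlas (EuclideanSpace ℝ (Fin n)) M) (h : SymTensor n M) (i j : Fin n) :
    ContDiffOn ℝ ∞ (coeff e h.field i j) e.target := by
  have hs : ContMDiffOn (𝓡 n) (𝓡 n) ∞ e.symm e.target :=
    contMDiffOn_symm_of_mem_maximalAtlas (IsManifold.subset_maximalAtlas he)
  have hh := (h.1.contMDiff.contMDiffOn (s := univ)).comp hs (fun _ _ => mem_univ _)
  have := ContMDiffOn.clm_bundle_apply₂ (F₁ := EuclideanSpace ℝ (Fin n))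
    (F₂ := EuclideanSpace ℝ (Fin n)) (F₃ := ℝ) (E₃ := Bundle.Trivial M ℝ)
    (E₁ := fun x : M => TangentSpace (𝓡 n) x) (E₂ := fun x : M => TangentSpace (𝓡 n) x)
    hh (contMDiffOn_coordVector he i) (contMDiffOn_coordVector he j)
  rw [← contMDiffOn_iff_contDiffOn]
  intro u hu
  have := this u hu
  rw [Bundle.contMDiffWithinAt_totalSpace] at this
  exact this.2

/-- The coordinate fields of two charts are related by the derivative of the transition map. -/
lemma coordVector_eq_mfderiv {e e' : OpenPartialHomeomorph M (EuclideanSpace ℝ (Fin n))}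
    (he : e ∈ atlas (EuclideanSpace ℝ (Fin n)) M) (he' : e' ∈ atlas (EuclideanSpace ℝ (Fin n)) M)
    {u : EuclideanSpace ℝ (Fin n)} (hu : u ∈ (e.symm.trans e').source) (i : Fin n) :
    coordVector e i u = (mfderiv (𝓡 n) (𝓡 n) e'.symm (e' (e.symm u)) :
      EuclideanSpace ℝ (Fin n) →L[ℝ] EuclideanSpace ℝ (Fin n))
      (fderiv ℝ (e' ∘ e.symm) u (EuclideanSpace.single i 1)) := by
  have hu1 : u ∈ e.target := by simpa using hu.1
  have hu2 : e.symm u ∈ e'.source := hu.2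
  have h1 : MDifferentiableAt (𝓡 n) (𝓡 n) e.symm u := mdifferentiableAt_atlas_symm he hu1
  have h2 : MDifferentiableAt (𝓡 n) (𝓡 n) e' (e.symm u) := mdifferentiableAt_atlas he' hu2
  have h3 : MDifferentiableAt (𝓡 n) (𝓡 n) e'.symm (e' (e.symm u)) :=
    mdifferentiableAt_atlas_symm he' (e'.map_source hu2)
  have h4 : MDifferentiableAt (𝓡 n) (𝓡 n) (e' ∘ e.symm) u := h2.comp u h1
  have h5 : e.symm =ᶠ[𝓝 u] e'.symm ∘ (e' ∘ e.symm) := by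
    filter_upwards [(e.symm.trans e').open_source.mem_nhds hu] with v hv
    exact (e'.left_inv hv.2).symm
  have h6 : mfderiv (𝓡 n) (𝓡 n) (e'.symm ∘ (e' ∘ e.symm)) u =
      (mfderiv (𝓡 n) (𝓡 n) e'.symm (e' (e.symm u))).comp
        (mfderiv (𝓡 n) (𝓡 n) (e' ∘ e.symm) u) := mfderiv_comp u h3 h4
  have h7 := h5.mfderiv_eq (I := 𝓡 n) (I' := 𝓡 n)
  rw [← mfderiv_eq_fderiv]
  exact (congrArg (fun L : EuclideanSpace ℝ (Fin n) →L[ℝ] EuclideanSpace ℝ (Fin n) =>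
    L (EuclideanSpace.single i 1)) (h7.trans h6))

/-- A bilinear form on `ℝⁿ`, in the basis of the images of the standard basis vectors under a
linear map. -/
lemma bilin_apply_linear
    (b : EuclideanSpace ℝ (Fin n) →L[ℝ] EuclideanSpace ℝ (Fin n) →L[ℝ] ℝ)
    (D : EuclideanSpace ℝ (Fin n) →L[ℝ] EuclideanSpace ℝ (Fin n)) :
    (Matrix.of fun i j => b (D (EuclideanSpace.single i 1)) (D (EuclideanSpace.single j 1))) =
    (LinearMap.toMatrix (EuclideanSpace.basisFun (Fin n) ℝ).toBasis
      (EuclideanSpace.basisFun (Fin n) ℝ).toBasis (D : EuclideanSpace ℝ (Fin n) →ₗ[ℝ] _)).transpose *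
    (Matrix.of fun i j => b (EuclideanSpace.single i 1) (EuclideanSpace.single j 1)) *
    (LinearMap.toMatrix (EuclideanSpace.basisFun (Fin n) ℝ).toBasis
      (EuclideanSpace.basisFun (Fin n) ℝ).toBasis (D : EuclideanSpace ℝ (Fin n) →ₗ[ℝ] _)) := by
  have hb : ∀ v : EuclideanSpace ℝ (Fin n), v = ∑ k, v k • EuclideanSpace.single k (1 : ℝ) := by
    intro v
    have := (EuclideanSpace.basisFun (Fin n) ℝ).sum_repr v
    simpa using this.symm
  ext i j
  simp only [Matrix.of_apply, Matrix.mul_apply, Matrix.transpose_apply, LinearMap.toMatrix_apply,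
    OrthonormalBasis.coe_toBasis, EuclideanSpace.basisFun_apply, ContinuousLinearMap.coe_coe,
    OrthonormalBasis.coe_toBasis_repr_apply, EuclideanSpace.basisFun_repr]
  conv_lhs => rw [hb (D (EuclideanSpace.single i 1)), hb (D (EuclideanSpace.single j 1))]
  simp only [map_sum, map_smul, _root_.sum_apply, _root_.smul_apply,
    smul_eq_mul, Finset.mul_sum, Finset.sum_mul]
  refine Finset.sum_congr rfl fun k _ => Finset.sum_congr rfl fun l _ => by ring

lemma det_bilin_apply_linear
    (b : EuclideanSpace ℝ (Fin n) →L[ℝ] EuclideanSpace ℝ (Fin n) →L[ℝ] ℝ)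
    (D : EuclideanSpace ℝ (Fin n) →L[ℝ] EuclideanSpace ℝ (Fin n)) :
    (Matrix.of fun i j =>
      b (D (EuclideanSpace.single i 1)) (D (EuclideanSpace.single j 1))).det =
    D.det ^ 2 *
      (Matrix.of fun i j => b (EuclideanSpace.single i 1) (EuclideanSpace.single j 1)).det := by
  rw [bilin_apply_linear, Matrix.det_mul, Matrix.det_mul, Matrix.det_transpose,
    LinearMap.det_toMatrix, ContinuousLinearMap.det]
  ring

/-- Transformation of the Gram determinant under a change of charts. -/
lemma det_coeff_change {e e' : OpenPartialHomeomorph M (EuclideanSpace ℝ (Fin n))}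
    (he : e ∈ atlas (EuclideanSpace ℝ (Fin n)) M) (he' : e' ∈ atlas (EuclideanSpace ℝ (Fin n)) M)
    (h : TensorField n M)
    {u : EuclideanSpace ℝ (Fin n)} (hu : u ∈ (e.symm.trans e').source) :
    (Matrix.of fun i j => coeff e h i j u).det = (fderiv ℝ (e' ∘ e.symm) u).det ^ 2 *
      (Matrix.of fun i j => coeff e' h i j (e' (e.symm u))).det := by
  have hx : e'.symm (e' (e.symm u)) = e.symm u := e'.left_inv hu.2
  have key : ∀ y, y = e.symm u →
      ∀ v w : EuclideanSpace ℝ (Fin n),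
      (h y : EuclideanSpace ℝ (Fin n) →L[ℝ] EuclideanSpace ℝ (Fin n) →L[ℝ] ℝ) v w =
      (h (e.symm u) : EuclideanSpace ℝ (Fin n) →L[ℝ] EuclideanSpace ℝ (Fin n) →L[ℝ] ℝ) v w := by
    rintro y rfl _ _; rfl
  set L : EuclideanSpace ℝ (Fin n) →L[ℝ] EuclideanSpace ℝ (Fin n) :=
    mfderiv (𝓡 n) (𝓡 n) e'.symm (e' (e.symm u)) with hL
  let b : EuclideanSpace ℝ (Fin n) →L[ℝ] EuclideanSpace ℝ (Fin n) →L[ℝ] ℝ := h (e.symm u)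
  have h1 : (Matrix.of fun i j => coeff e h i j u) = Matrix.of fun i j =>
      (b.bilinearComp L L) (fderiv ℝ (e' ∘ e.symm) u (EuclideanSpace.single i 1))
        (fderiv ℝ (e' ∘ e.symm) u (EuclideanSpace.single j 1)) := by
    ext i j
    simp only [Matrix.of_apply, coeff]
    rw [coordVector_eq_mfderiv he he' hu, coordVector_eq_mfderiv he he' hu]
    rfl
  have h2 : (Matrix.of fun i j => coeff e' h i j (e' (e.symm u))) = Matrix.of fun i j =>
      (b.bilinearComp L L) (EuclideanSpace.single i 1) (EuclideanSpace.single j 1) := by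
    ext i j
    exact key _ hx _ _
  rw [h1, h2, det_bilin_apply_linear]

lemma det_mfderiv_symm_ne_zero {e : OpenPartialHomeomorph M (EuclideanSpace ℝ (Fin n))}
    (he : e ∈ atlas (EuclideanSpace ℝ (Fin n)) M) {u : EuclideanSpace ℝ (Fin n)}
    (hu : u ∈ e.target) :
    (mfderiv (𝓡 n) (𝓡 n) e.symm u :
      EuclideanSpace ℝ (Fin n) →L[ℝ] EuclideanSpace ℝ (Fin n)).det ≠ 0 := by
  have h : Function.Injective (mfderiv (𝓡 n) (𝓡 n) e.symm u) :=
    (mdifferentiable_of_mem_atlas (I := 𝓡 n) he).symm.mfderiv_injective hu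
  set D : EuclideanSpace ℝ (Fin n) →L[ℝ] EuclideanSpace ℝ (Fin n) :=
    mfderiv (𝓡 n) (𝓡 n) e.symm u
  have hD : Function.Injective D := h
  intro h0
  obtain ⟨v, hv, hv0⟩ := LinearMap.bot_lt_ker_of_det_eq_zero (f := D.toLinearMap) h0 |>
    (Submodule.ne_bot_iff _).1 ∘ bot_lt_iff_ne_bot.1
  exact hv0 (hD (by simpa using hv))

lemma formMatrix_posDef {g : SymTensor n M} (hg : g ∈ riemMetrics n M) (x : M) :
    (formMatrix x (g.field x)).PosDef := by
  let b : EuclideanSpace ℝ (Fin n) →L[ℝ] EuclideanSpace ℝ (Fin n) →L[ℝ] ℝ := g.field x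
  refine Matrix.PosDef.of_dotProduct_mulVec_pos ?_ fun {v} hv => ?_
  · ext i j
    exact g.2 x _ _
  · have hv' : (WithLp.toLp 2 v : EuclideanSpace ℝ (Fin n)) ≠ 0 := by
      simpa using hv
    have h1 : 0 < b (WithLp.toLp 2 v) (WithLp.toLp 2 v) := hg x _ hv'
    have hb : (WithLp.toLp 2 v : EuclideanSpace ℝ (Fin n)) =
        ∑ k, v k • EuclideanSpace.single k (1 : ℝ) := by
      have := (EuclideanSpace.basisFun (Fin n) ℝ).sum_repr (WithLp.toLp 2 v)
      simpa using this.symm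
    refine h1.trans_eq ?_
    rw [hb]
    simp only [map_sum, map_smul, _root_.sum_apply, _root_.smul_apply, smul_eq_mul,
      Finset.mul_sum, dotProduct, Matrix.mulVec, formMatrix, Matrix.of_apply, star_trivial]
    rw [Finset.sum_comm]
    refine Finset.sum_congr rfl fun k _ => Finset.sum_congr rfl fun l _ => ?_
    show v l * (v k * b _ _) = v k * (b _ _ * v l)
    ring

lemma det_coeff_pos {g : SymTensor n M} (hg : g ∈ riemMetrics n M)
    {e : OpenPartialHomeomorph M (EuclideanSpace ℝ (Fin n))}
    (he : e ∈ atlas (EuclideanSpace ℝ (Fin n)) M) {u : EuclideanSpace ℝ (Fin n)}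
    (hu : u ∈ e.target) :
    0 < (Matrix.of fun i j => coeff e g.field i j u).det := by
  have h1 : (Matrix.of fun i j => coeff e g.field i j u).det = (mfderiv (𝓡 n) (𝓡 n) e.symm u :
      EuclideanSpace ℝ (Fin n) →L[ℝ] EuclideanSpace ℝ (Fin n)).det ^ 2 *
      (formMatrix (e.symm u) (g.field (e.symm u))).det :=
    det_bilin_apply_linear (g.field (e.symm u) : EuclideanSpace ℝ (Fin n) →L[ℝ]
      EuclideanSpace ℝ (Fin n) →L[ℝ] ℝ) (mfderiv (𝓡 n) (𝓡 n) e.symm u)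
  rw [h1]
  exact mul_pos (by have := det_mfderiv_symm_ne_zero he hu; positivity)
    (formMatrix_posDef hg _).det_pos

lemma coordVector_ne_zero {e : OpenPartialHomeomorph M (EuclideanSpace ℝ (Fin n))}
    (he : e ∈ atlas (EuclideanSpace ℝ (Fin n)) M) {u : EuclideanSpace ℝ (Fin n)}
    (hu : u ∈ e.target) (i : Fin n) : coordVector e i u ≠ 0 := by
  have h : Function.Injective (mfderiv (𝓡 n) (𝓡 n) e.symm u) :=
    (mdifferentiable_of_mem_atlas (I := 𝓡 n) he).symm.mfderiv_injective hu
  intro h0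
  have h1 : (EuclideanSpace.single i (1 : ℝ) : EuclideanSpace ℝ (Fin n)) = 0 :=
    h (h0.trans (map_zero _).symm)
  have := congrArg (fun v : EuclideanSpace ℝ (Fin n) => v i) h1
  simp at this

lemma coeff_self_pos {g : SymTensor n M} (hg : g ∈ riemMetrics n M)
    {e : OpenPartialHomeomorph M (EuclideanSpace ℝ (Fin n))}
    (he : e ∈ atlas (EuclideanSpace ℝ (Fin n)) M) {u : EuclideanSpace ℝ (Fin n)}
    (hu : u ∈ e.target) (i : Fin n) : 0 < coeff e g.field i i u :=
  hg _ _ (coordVector_ne_zero he hu i)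

/-- A bilinear form is determined by its coefficients in a chart. -/
lemma form_apply_eq_sum_coeff {e : OpenPartialHomeomorph M (EuclideanSpace ℝ (Fin n))}
    (he : e ∈ atlas (EuclideanSpace ℝ (Fin n)) M) {u : EuclideanSpace ℝ (Fin n)}
    (hu : u ∈ e.target) (v w : TangentSpace (𝓡 n) (e.symm u)) :
    ∃ c d : Fin n → ℝ, ∀ h : TensorField n M,
      h (e.symm u) v w = ∑ i, ∑ j, c i * d j * coeff e h i j u := by
  have hs : Function.Surjective (mfderiv (𝓡 n) (𝓡 n) e.symm u) :=
    (mdifferentiable_of_mem_atlas (I := 𝓡 n) he).symm.mfderiv_surjective hu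
  set D : EuclideanSpace ℝ (Fin n) →L[ℝ] EuclideanSpace ℝ (Fin n) :=
    mfderiv (𝓡 n) (𝓡 n) e.symm u with hD
  obtain ⟨c, hc⟩ : ∃ c : EuclideanSpace ℝ (Fin n), D c = v := hs v
  obtain ⟨d, hd⟩ : ∃ c : EuclideanSpace ℝ (Fin n), D c = w := hs w
  have hb : ∀ v : EuclideanSpace ℝ (Fin n), v = ∑ k, v k • EuclideanSpace.single k (1 : ℝ) := by
    intro v
    have := (EuclideanSpace.basisFun (Fin n) ℝ).sum_repr v
    simpa using this.symm
  refine ⟨c, d, fun h => ?_⟩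
  let b : EuclideanSpace ℝ (Fin n) →L[ℝ] EuclideanSpace ℝ (Fin n) →L[ℝ] ℝ := h (e.symm u)
  have h1 : h (e.symm u) v w = b (D c) (D d) := by rw [hc, hd]; rfl
  have h2 : ∀ i j, coeff e h i j u =
    b (D (EuclideanSpace.single i 1)) (D (EuclideanSpace.single j 1)) := fun i j => rfl
  simp only [h1, h2]
  conv_lhs => rw [hb c, hb d]
  simp only [map_sum, map_smul, _root_.sum_apply, _root_.smul_apply, smul_eq_mul,
    Finset.mul_sum]
  rw [Finset.sum_comm]
  refine Finset.sum_congr rfl fun k _ => Finset.sum_congr rfl fun l _ => ?_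
  ring

end coordinates

/-! ### The volume measure in a chart -/

section volume

/-- Measures carried by the members of a countable cover that agree on overlaps are glued by their
supremum. -/
lemma restrict_iSup_of_compatible {α ι : Type*} [MeasurableSpace α] {m : ι → Measure α}
    {s : ι → Set α} (hs : ∀ i, MeasurableSet (s i)) (hm : ∀ i, m i (s i)ᶜ = 0)
    (hcomp : ∀ i j A, MeasurableSet A → A ⊆ s i → A ⊆ s j → m i A = m j A)
    {J : Set ι} (hJ : J.Countable) (hcov : ⋃ i ∈ J, s i = univ) (i : ι) :
    (⨆ i, m i).restrict (s i) = m i := by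
  obtain ⟨j, hj⟩ := (hJ.insert i).exists_eq_range (insert_nonempty _ _)
  have hcov' : ⋃ k, s (j k) = univ := by
    refine eq_univ_of_forall fun x => ?_
    have hx : x ∈ ⋃ i ∈ J, s i := hcov ▸ mem_univ x
    obtain ⟨l, hl, hx⟩ := mem_iUnion₂.1 hx
    obtain ⟨k, rfl⟩ : l ∈ range j := hj ▸ mem_insert_of_mem _ hl
    exact mem_iUnion.2 ⟨k, hx⟩
  set A : ℕ → Set α := disjointed fun k => s (j k) with hA
  have hAm : ∀ k, MeasurableSet (A k) := fun k => MeasurableSet.disjointed (fun k => hs (j k)) k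
  have hAd : Pairwise (Function.onFun Disjoint A) := disjoint_disjointed _
  have hAs : ∀ k, A k ⊆ s (j k) := fun k => disjointed_subset _ k
  have hAu : ⋃ k, A k = univ := (iUnion_disjointed).trans hcov'
  -- every `μ B` is the sum over the pieces
  have hsum : ∀ (μ : Measure α) (B : Set α), MeasurableSet B → μ B = ∑' k, μ (B ∩ A k) := by
    intro μ B hB
    rw [← measure_iUnion (fun k l hkl => (hAd hkl).mono inter_subset_right inter_subset_right)
      (fun k => hB.inter (hAm k)), ← inter_iUnion, hAu, inter_univ]
  set ν : Measure α := Measure.sum fun k => (m (j k)).restrict (A k) with hν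
  have hνB : ∀ B, MeasurableSet B → ν B = ∑' k, m (j k) (B ∩ A k) := by
    intro B hB
    rw [hν, Measure.sum_apply _ hB]
    simp only [Measure.restrict_apply hB]
  have hms : ∀ l B, m l B = m l (B ∩ s l) := by
    intro l B
    refine le_antisymm ?_ (measure_mono inter_subset_left)
    calc m l B ≤ m l ((B ∩ s l) ∪ (s l)ᶜ) := measure_mono fun x hx => by
          by_cases h : x ∈ s l
          · exact Or.inl ⟨hx, h⟩
          · exact Or.inr h
      _ ≤ m l (B ∩ s l) + m l (s l)ᶜ := measure_union_le _ _
      _ = m l (B ∩ s l) := by rw [hm, add_zero]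
  have hle : ∀ l, m l ≤ ν := by
    intro l
    refine Measure.le_iff.2 fun B hB => ?_
    rw [hsum (m l) B hB, hνB B hB]
    refine ENNReal.tsum_le_tsum fun k => ?_
    rw [hms l (B ∩ A k), hcomp l (j k) _ ((hB.inter (hAm k)).inter (hs l)) inter_subset_right
      (inter_subset_left.trans (inter_subset_right.trans (hAs k)))]
    exact measure_mono inter_subset_left
  have hνi : ∀ B, MeasurableSet B → B ⊆ s i → ν B = m i B := by
    intro B hB hBi
    rw [hsum (m i) B hB, hνB B hB]
    refine tsum_congr fun k => ?_
    exact hcomp _ _ _ (hB.inter (hAm k)) (inter_subset_right.trans (hAs k))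
      (inter_subset_left.trans hBi)
  ext B hB
  rw [Measure.restrict_apply hB]
  refine le_antisymm ?_ ?_
  · refine (Measure.le_iff.1 (iSup_le hle) _ (hB.inter (hs i))).trans ?_
    rw [hνi _ (hB.inter (hs i)) inter_subset_right]
    exact measure_mono inter_subset_left
  · rw [hms i B]
    exact Measure.le_iff.1 (le_iSup m i) _ (hB.inter (hs i))

variable {n : ℕ} {M : Type*} [TopologicalSpace M]

variable (n M) in
lemma exists_countable_atlas_cover [ChartedSpace (EuclideanSpace ℝ (Fin n)) M] [CompactSpace M] :
    ∃ J : Set (atlas (EuclideanSpace ℝ (Fin n)) M), J.Countable ∧ ⋃ e ∈ J, e.1.source = univ := by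
  obtain ⟨t, ht⟩ := CompactSpace.elim_nhds_subcover
    (fun x : M => (chartAt (EuclideanSpace ℝ (Fin n)) x).source)
    (fun x => (chartAt _ x).open_source.mem_nhds (mem_chart_source _ x))
  refine ⟨(fun x => ⟨chartAt (EuclideanSpace ℝ (Fin n)) x, chart_mem_atlas _ x⟩) '' (t : Set M),
    t.countable_toSet.image _, ?_⟩
  rw [biUnion_image]
  simpa using ht

variable [MeasurableSpace M] [BorelSpace M]

lemma aemeasurable_chart_symm (e : OpenPartialHomeomorph M (EuclideanSpace ℝ (Fin n))) :
    AEMeasurable e.symm (volume.restrict e.target) :=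
  e.continuousOn_symm.aemeasurable₀ e.open_target.nullMeasurableSet

lemma measurableSet_chart_preimage (e : OpenPartialHomeomorph M (EuclideanSpace ℝ (Fin n)))
    {A : Set M} (hA : MeasurableSet A) : MeasurableSet (e.symm ⁻¹' A ∩ e.target) := by
  have h1 : Measurable (e.target.domRestrict e.symm) :=
    (continuousOn_iff_continuous_domRestrict.1 e.continuousOn_symm).measurable
  have h2 := e.open_target.measurableSet.subtype_image (h1 hA)
  convert h2 using 1
  ext u
  simp [and_comm]

variable [ChartedSpace (EuclideanSpace ℝ (Fin n)) M] [IsManifold (𝓡 n) ∞ M]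

lemma chartVolume_apply (e : OpenPartialHomeomorph M (EuclideanSpace ℝ (Fin n)))
    (h : TensorField n M) {A : Set M} (hA : MeasurableSet A) :
    chartVolume e h A = ∫⁻ u in e.symm ⁻¹' A ∩ e.target,
      ENNReal.ofReal (√(Matrix.det (Matrix.of (fun i j => coeff e h i j u)))) := by
  have h1 := (aemeasurable_chart_symm e)
  have h2 : NullMeasurableSet (e.symm ⁻¹' A) (volume.restrict e.target) :=
    h1.nullMeasurableSet_preimage hA
  rw [chartVolume, Measure.map_apply_of_aemeasurable
    (h1.mono_ac (withDensity_absolutelyContinuous _ _)) hA, withDensity_apply₀ _ h2,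
    Measure.restrict_restrict₀ h2]

lemma chartVolume_compl_source (e : OpenPartialHomeomorph M (EuclideanSpace ℝ (Fin n)))
    (h : TensorField n M) : chartVolume e h e.sourceᶜ = 0 := by
  rw [chartVolume_apply e h e.open_source.measurableSet.compl]
  have : e.symm ⁻¹' e.sourceᶜ ∩ e.target = ∅ := by
    ext u
    simp only [mem_inter_iff, mem_preimage, mem_compl_iff, mem_empty_iff_false, iff_false, not_and]
    exact fun h1 h2 => h1 (e.map_target h2)
  rw [this, Measure.restrict_empty, lintegral_zero_measure]

/-- The local volume measures of two charts agree on the overlap, by the change of variables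
formula. -/
lemma chartVolume_eq_of_subset {e e' : OpenPartialHomeomorph M (EuclideanSpace ℝ (Fin n))}
    (he : e ∈ atlas (EuclideanSpace ℝ (Fin n)) M) (he' : e' ∈ atlas (EuclideanSpace ℝ (Fin n)) M)
    (h : TensorField n M) {A : Set M} (hA : MeasurableSet A) (hAe : A ⊆ e.source)
    (hAe' : A ⊆ e'.source) : chartVolume e h A = chartVolume e' h A := by
  rw [chartVolume_apply e h hA, chartVolume_apply e' h hA]
  set S := e.symm ⁻¹' A ∩ e.target with hS
  have hSs : ∀ u ∈ S, u ∈ (e.symm.trans e').source := fun u hu => ⟨by simpa using hu.2, hAe' hu.1⟩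
  have himg : (e' ∘ e.symm) '' S = e'.symm ⁻¹' A ∩ e'.target := by
    ext v
    constructor
    · rintro ⟨u, hu, rfl⟩
      have h1 := hAe' hu.1
      refine ⟨?_, e'.map_source h1⟩
      simp only [Function.comp, mem_preimage, e'.left_inv h1]
      exact hu.1
    · rintro ⟨h1, h2⟩
      refine ⟨e (e'.symm v), ⟨?_, e.map_source (hAe h1)⟩, ?_⟩
      · simpa only [mem_preimage, e.left_inv (hAe h1)] using h1
      · simp only [Function.comp, e.left_inv (hAe h1), e'.right_inv h2]
  have hinj : InjOn (e' ∘ e.symm) S := by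
    intro u hu v hv huv
    exact e.symm.injOn (by simpa using hu.2) (by simpa using hv.2)
      (e'.injOn (hAe' hu.1) (hAe' hv.1) huv)
  have hder : ∀ u ∈ S, HasFDerivWithinAt (e' ∘ e.symm) (fderiv ℝ (e' ∘ e.symm) u) S u := by
    intro u hu
    have h1 : MDifferentiableAt (𝓡 n) (𝓡 n) e.symm u := mdifferentiableAt_atlas_symm he hu.2
    have h2 : MDifferentiableAt (𝓡 n) (𝓡 n) e' (e.symm u) :=
      mdifferentiableAt_atlas he' (hAe' hu.1)
    exact ((mdifferentiableAt_iff_differentiableAt.1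
      (h2.comp u h1)).hasFDerivAt).hasFDerivWithinAt
  rw [← himg, lintegral_image_eq_lintegral_abs_det_fderiv_mul volume
    (measurableSet_chart_preimage e hA) hder hinj]
  refine setLIntegral_congr_fun (measurableSet_chart_preimage e hA) fun u hu => ?_
  simp only [Function.comp]
  rw [det_coeff_change he he' h (hSs u hu), Real.sqrt_mul (sq_nonneg _), Real.sqrt_sq_eq_abs,
    ENNReal.ofReal_mul (abs_nonneg _)]

variable [CompactSpace M]

/-- In every chart, `μ_h` is given by the density `√(det (h_ij))`. -/
lemma volMeasure_restrict_source (h : TensorField n M)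
    {e : OpenPartialHomeomorph M (EuclideanSpace ℝ (Fin n))}
    (he : e ∈ atlas (EuclideanSpace ℝ (Fin n)) M) :
    (volMeasure h).restrict e.source = chartVolume e h := by
  obtain ⟨J, hJ, hcov⟩ := exists_countable_atlas_cover n M
  exact restrict_iSup_of_compatible
    (m := fun e : atlas (EuclideanSpace ℝ (Fin n)) M => chartVolume e.1 h)
    (s := fun e => e.1.source)
    (fun e => e.1.open_source.measurableSet) (fun e => chartVolume_compl_source e.1 h)
    (fun e e' A hA h1 h2 => chartVolume_eq_of_subset e.2 e'.2 h hA h1 h2) hJ hcov ⟨e, he⟩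

/-- The volume of a smooth tensor field is finite, since its density is continuous in charts. -/
lemma isFiniteMeasure_volMeasure (h : SymTensor n M) : IsFiniteMeasure (volMeasure h.field) := by
  have : IsLocallyFiniteMeasure (volMeasure h.field) := by
    refine ⟨fun x => ?_⟩
    set e := chartAt (EuclideanSpace ℝ (Fin n)) x with he
    have hea : e ∈ atlas (EuclideanSpace ℝ (Fin n)) M := chart_mem_atlas _ x
    have hx : x ∈ e.source := mem_chart_source _ x
    obtain ⟨r, hr, hrt⟩ := Metric.nhds_basis_closedBall.mem_iff.1
      (e.open_target.mem_nhds (e.map_source hx))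
    have hcont : ContinuousOn
        (fun u => √(Matrix.det (Matrix.of (fun i j => coeff e h.field i j u)))) e.target := by
      refine Real.continuous_sqrt.comp_continuousOn ?_
      refine (continuous_id.matrix_det).comp_continuousOn ?_
      exact continuousOn_pi.2 fun i => continuousOn_pi.2 fun j =>
        (contDiffOn_coeff hea h i j).continuousOn
    obtain ⟨C, hC⟩ := (isCompact_closedBall (e x) r).exists_bound_of_continuousOn (hcont.mono hrt)
    have hO : IsOpen (e.source ∩ e ⁻¹' Metric.ball (e x) r) :=
      e.isOpen_inter_preimage Metric.isOpen_ball
    refine ⟨e.source ∩ e ⁻¹' Metric.ball (e x) r,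
      hO.mem_nhds ⟨hx, Metric.mem_ball_self hr⟩, ?_⟩
    have h1 : volMeasure h.field (e.source ∩ e ⁻¹' Metric.ball (e x) r) =
        chartVolume e h.field (e.source ∩ e ⁻¹' Metric.ball (e x) r) := by
      rw [← volMeasure_restrict_source h.field hea, Measure.restrict_apply hO.measurableSet]
      congr 1
      ext y
      simp only [mem_inter_iff]
      tauto
    rw [h1, chartVolume_apply _ _ hO.measurableSet]
    have hsub : e.symm ⁻¹' (e.source ∩ e ⁻¹' Metric.ball (e x) r) ∩ e.target ⊆
        Metric.ball (e x) r := by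
      rintro u ⟨⟨_, h2⟩, h3⟩
      simpa only [mem_preimage, e.right_inv h3] using h2
    calc _ ≤ ∫⁻ u in e.symm ⁻¹' (e.source ∩ e ⁻¹' Metric.ball (e x) r) ∩ e.target,
          ENNReal.ofReal C := by
          refine setLIntegral_mono measurable_const fun u hu => ENNReal.ofReal_le_ofReal ?_
          exact (le_abs_self _).trans (hC u (Metric.ball_subset_closedBall (hsub hu)))
      _ ≤ ENNReal.ofReal C * volume (Metric.ball (e x) r) := by
          rw [setLIntegral_const]
          gcongr
      _ < ⊤ := ENNReal.mul_lt_top ENNReal.ofReal_lt_top measure_ball_lt_top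
  infer_instance

end volume

/-! ### Volume and `L²` metric of conformal multiples -/

section conformal
variable {n : ℕ} {M : Type*} [TopologicalSpace M]
  [ChartedSpace (EuclideanSpace ℝ (Fin n)) M] [IsManifold (𝓡 n) ∞ M]

lemma sqrt_det_coeff_conf (e : OpenPartialHomeomorph M (EuclideanSpace ℝ (Fin n))) {ρ : M → ℝ}
    (g : SymTensor n M) (u : EuclideanSpace ℝ (Fin n)) (hρ : 0 ≤ ρ (e.symm u)) :
    √(Matrix.det (Matrix.of (fun i j => coeff e (conf ρ g) i j u))) =
      √(Matrix.det (Matrix.of (fun i j => coeff e g.field i j u))) *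
        ρ (e.symm u) ^ ((n : ℝ) / 2) := by
  have h1 : Matrix.of (fun i j => coeff e (conf ρ g) i j u) =
      ρ (e.symm u) • Matrix.of (fun i j => coeff e g.field i j u) := by
    ext i j; rfl
  rw [h1, Matrix.det_smul, Fintype.card_fin, Real.sqrt_mul (pow_nonneg hρ n), mul_comm]
  congr 1
  rw [Real.sqrt_eq_rpow, ← Real.rpow_natCast, ← Real.rpow_mul hρ]
  congr 1
  ring

lemma aemeasurable_sqrt_det_coeff {e : OpenPartialHomeomorph M (EuclideanSpace ℝ (Fin n))}
    (he : e ∈ atlas (EuclideanSpace ℝ (Fin n)) M) (h : SymTensor n M) :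
    AEMeasurable (fun u => ENNReal.ofReal (√(Matrix.det (Matrix.of
      (fun i j => coeff e h.field i j u))))) (volume.restrict e.target) := by
  have hcont : ContinuousOn
      (fun u => √(Matrix.det (Matrix.of (fun i j => coeff e h.field i j u)))) e.target := by
    refine Real.continuous_sqrt.comp_continuousOn ?_
    refine (continuous_id.matrix_det).comp_continuousOn ?_
    exact continuousOn_pi.2 fun i => continuousOn_pi.2 fun j =>
      (contDiffOn_coeff he h i j).continuousOn
  exact ENNReal.measurable_ofReal.comp_aemeasurable
    (hcont.aemeasurable e.open_target.measurableSet)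

/-- The density of a metric is positive, so that null sets of the volume are null sets in charts. -/
lemma volume_restrict_absolutelyContinuous {g : SymTensor n M} (hg : g ∈ riemMetrics n M)
    {e : OpenPartialHomeomorph M (EuclideanSpace ℝ (Fin n))}
    (he : e ∈ atlas (EuclideanSpace ℝ (Fin n)) M) :
    volume.restrict e.target ≪ (volume.restrict e.target).withDensity
      (fun u => ENNReal.ofReal (√(Matrix.det (Matrix.of (fun i j => coeff e g.field i j u))))) := by
  refine withDensity_absolutelyContinuous' (aemeasurable_sqrt_det_coeff he g) ?_
  filter_upwards [ae_restrict_mem e.open_target.measurableSet] with u hu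
  exact (ENNReal.ofReal_pos.2 (Real.sqrt_pos.2 (det_coeff_pos hg he hu))).ne'

lemma withDensity_map {α β : Type*} [MeasurableSpace α] [MeasurableSpace β] {μ : Measure α}
    {f : α → β} (hf : AEMeasurable f μ) {G : β → ENNReal} (hG : AEMeasurable G (μ.map f)) :
    (μ.map f).withDensity G = (μ.withDensity (G ∘ f)).map f := by
  ext A hA
  have h2 : NullMeasurableSet (f ⁻¹' A) μ := hf.nullMeasurableSet_preimage hA
  rw [withDensity_apply _ hA, Measure.map_apply_of_aemeasurable
    (hf.mono_ac (withDensity_absolutelyContinuous _ _)) hA, withDensity_apply₀ _ h2,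
    Measure.restrict_map_of_aemeasurable hf hA, lintegral_map' ?_ ?_]
  · rfl
  · rw [← Measure.restrict_map_of_aemeasurable hf hA]
    exact hG.restrict
  · exact hf.restrict

/-- The integrand of the `L²` metric in conformal directions. -/
lemma traceProd_conf {g : SymTensor n M} (hg : g ∈ riemMetrics n M) {x : M} {h k : SymTensor n M}
    {r s : ℝ} (hr : r ≠ 0) (hh : h.field x = r • g.field x) (hk : k.field x = s • g.field x) :
    traceProd h.field k.field k.field x = n * (s / r) ^ 2 := by
  have h1 : formMatrix x (h.field x) = r • formMatrix x (g.field x) := by rw [hh]; rfl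
  have h2 : formMatrix x (k.field x) = s • formMatrix x (g.field x) := by rw [hk]; rfl
  have hu : IsUnit (formMatrix x (g.field x)).det := (formMatrix_posDef hg x).det_pos.ne'.isUnit
  have h3 : (formMatrix x (h.field x))⁻¹ * formMatrix x (k.field x) =
      (s / r) • (1 : Matrix (Fin n) (Fin n) ℝ) := by
    have : (r • formMatrix x (g.field x))⁻¹ = r⁻¹ • (formMatrix x (g.field x))⁻¹ :=
      Matrix.inv_smul' _ (Units.mk0 r hr) hu
    rw [h1, h2, this, Matrix.smul_mul, Matrix.mul_smul, Matrix.nonsing_inv_mul _ hu, smul_smul,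
      inv_mul_eq_div]
  rw [traceProd, mul_assoc, h3, Matrix.smul_mul, Matrix.mul_smul, mul_one, smul_smul,
    Matrix.trace_smul, Matrix.trace_one, Fintype.card_fin, smul_eq_mul]
  ring

/-- Multiplying a density by a function pulled back along `f` multiplies the image measure. -/
lemma map_withDensity_mul {α β : Type*} [MeasurableSpace α] [MeasurableSpace β] {μ : Measure α}
    {f : α → β} {F F' : α → ENNReal} {G : β → ENNReal} (hf : AEMeasurable f μ)
    (hF : AEMeasurable F μ) (hac : μ ≪ μ.withDensity F)
    (hG : AEMeasurable G ((μ.withDensity F).map f)) (hF' : F' =ᵐ[μ] F * (G ∘ f)) :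
    (μ.withDensity F').map f = ((μ.withDensity F).map f).withDensity G := by
  have hf' := hf.mono_ac (withDensity_absolutelyContinuous μ F)
  rw [withDensity_map hf' hG, withDensity_congr_ae hF',
    withDensity_mul₀ hF ((hG.comp_aemeasurable hf').mono_ac hac)]

variable [MeasurableSpace M] [BorelSpace M] [CompactSpace M]

lemma ae_of_ae_map_withDensity {α β : Type*} [MeasurableSpace α] [MeasurableSpace β]
    {μ : Measure α} {f : α → β} {F : α → ENNReal} (hf : AEMeasurable f μ)
    (hac : μ ≪ μ.withDensity F) {p : β → Prop} (h : ∀ᵐ x ∂((μ.withDensity F).map f), p x) :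
    ∀ᵐ u ∂μ, p (f u) :=
  hac.ae_le (ae_of_ae_map (hf.mono_ac (withDensity_absolutelyContinuous μ F)) h)

lemma chartVolume_le_volMeasure (h : TensorField n M)
    {e : OpenPartialHomeomorph M (EuclideanSpace ℝ (Fin n))}
    (he : e ∈ atlas (EuclideanSpace ℝ (Fin n)) M) : chartVolume e h ≤ volMeasure h := by
  rw [← volMeasure_restrict_source h he]
  exact Measure.restrict_le_self

lemma chartVolume_conf {g : SymTensor n M} (hg : g ∈ riemMetrics n M) {ρ : M → ℝ}
    (hρ : AEMeasurable ρ (volMeasure g.field)) (hρ0 : ∀ᵐ x ∂(volMeasure g.field), 0 ≤ ρ x)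
    {e : OpenPartialHomeomorph M (EuclideanSpace ℝ (Fin n))}
    (he : e ∈ atlas (EuclideanSpace ℝ (Fin n)) M) :
    chartVolume e (conf ρ g) = (chartVolume e g.field).withDensity
      (fun x => ENNReal.ofReal (ρ x ^ ((n : ℝ) / 2))) := by
  have hle := chartVolume_le_volMeasure g.field he
  have hG : AEMeasurable (fun x => ENNReal.ofReal (ρ x ^ ((n : ℝ) / 2)))
      (chartVolume e g.field) :=
    ENNReal.measurable_ofReal.comp_aemeasurable ((hρ.mono_measure hle).pow_const _)
  have hpos1 : ∀ᵐ x ∂(chartVolume e g.field), 0 ≤ ρ x := ae_mono hle hρ0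
  have hsymm := aemeasurable_chart_symm e
  have hac := volume_restrict_absolutelyContinuous hg he
  have hpos : ∀ᵐ u ∂(volume.restrict e.target), 0 ≤ ρ (e.symm u) :=
    ae_of_ae_map_withDensity hsymm hac hpos1
  refine map_withDensity_mul hsymm (aemeasurable_sqrt_det_coeff he g) hac hG ?_
  filter_upwards [hpos] with u hu
  rw [sqrt_det_coeff_conf _ _ _ hu, ENNReal.ofReal_mul (Real.sqrt_nonneg _)]
  rfl

/-- The volume of a conformal multiple of a metric: `μ_{ρ g} = ρ^(n/2) μ_g`. -/
lemma volMeasure_conf {g : SymTensor n M} (hg : g ∈ riemMetrics n M) {ρ : M → ℝ}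
    (hρ : AEMeasurable ρ (volMeasure g.field)) (hρ0 : ∀ᵐ x ∂(volMeasure g.field), 0 ≤ ρ x) :
    volMeasure (conf ρ g) = (volMeasure g.field).withDensity
      (fun x => ENNReal.ofReal (ρ x ^ ((n : ℝ) / 2))) := by
  obtain ⟨J, hJ, hcov⟩ := exists_countable_atlas_cover n M
  refine (Measure.ext_iff_of_biUnion_eq_univ hJ hcov).2 fun e _ => ?_
  rw [volMeasure_restrict_source _ e.2, restrict_withDensity e.1.open_source.measurableSet,
    volMeasure_restrict_source _ e.2, chartVolume_conf hg hρ hρ0 e.2]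

/-- The `L²` metric on the conformal orbit: the substitution `f = ρ^(n/4)` makes it flat. -/
lemma l2Metric_conf {g : SymTensor n M} (hg : g ∈ riemMetrics n M) {h k : SymTensor n M}
    {ρ σ : M → ℝ} (hρc : Continuous ρ) (hρ : ∀ x, 0 < ρ x) (hh : ∀ x, h.field x = ρ x • g.field x)
    (hk : ∀ x, k.field x = σ x • g.field x) :
    l2Metric h k k = n * ∫ x, (ρ x ^ ((n : ℝ) / 4 - 1) * σ x) ^ 2 ∂(volMeasure g.field) := by
  have h1 : h.field = conf ρ g := funext hh
  rw [l2Metric, h1, volMeasure_conf hg hρc.measurable.aemeasurable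
    (Eventually.of_forall fun x => (hρ x).le)]
  rw [integral_withDensity_eq_integral_toReal_smul₀ (f := fun x =>
      ENNReal.ofReal (ρ x ^ ((n : ℝ) / 2))) (ENNReal.measurable_ofReal.comp_aemeasurable
      (hρc.measurable.aemeasurable.pow_const _))
    (Eventually.of_forall fun _ => ENNReal.ofReal_lt_top), ← integral_const_mul]
  refine integral_congr_ae (Eventually.of_forall fun x => ?_)
  simp only
  rw [← h1, traceProd_conf hg (hρ x).ne' (hh x) (hk x), smul_eq_mul,
    ENNReal.toReal_ofReal (Real.rpow_nonneg (hρ x).le _), Real.rpow_sub_one (hρ x).ne', mul_pow,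
    div_pow, div_pow]
  have : (ρ x ^ ((n : ℝ) / 4)) ^ 2 = ρ x ^ ((n : ℝ) / 2) := by
    rw [← Real.rpow_natCast, ← Real.rpow_mul (hρ x).le]
    congr 1
    push_cast
    ring
  rw [this]
  ring

end conformal

/-! ### The exponential chart -/

section exponentialChart

lemma memLp_const_add_const_mul {α : Type*} [MeasurableSpace α] {μ : Measure α}
    [IsFiniteMeasure μ] {f : α → ℝ} (hf : MemLp f 2 μ) (a c : ℝ) :
    MemLp (fun x => a + c * f x) 2 μ :=
  (memLp_const a).add (hf.const_mul c)

variable {n : ℕ} {M : Type*} [TopologicalSpace M]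
  [ChartedSpace (EuclideanSpace ℝ (Fin n)) M] [IsManifold (𝓡 n) ∞ M]

lemma smul_field_injective (hn : 0 < n) {g : SymTensor n M} (hg : g ∈ riemMetrics n M) {x : M}
    {r s : ℝ} (h : r • g.field x = s • g.field x) : r = s := by
  have hv : (EuclideanSpace.single ⟨0, hn⟩ (1 : ℝ) : EuclideanSpace ℝ (Fin n)) ≠ 0 := by simp
  have h1 := hg x (EuclideanSpace.single ⟨0, hn⟩ (1 : ℝ) : EuclideanSpace ℝ (Fin n)) hv
  set v : TangentSpace (𝓡 n) x := (EuclideanSpace.single ⟨0, hn⟩ (1 : ℝ) : EuclideanSpace ℝ (Fin n))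
  have h2 : r * g.field x v v = s * g.field x v v :=
    congrArg (fun b : TangentSpace (𝓡 n) x →L[ℝ] TangentSpace (𝓡 n) x →L[ℝ] ℝ => b v v) h
  exact mul_right_cancel₀ h1.ne' h2

lemma rpow_four_div_rpow_div_four (hn : 0 < n) {a : ℝ} (ha : 0 ≤ a) :
    (a ^ (4 / (n : ℝ))) ^ ((n : ℝ) / 4) = a := by
  have : (n : ℝ) ≠ 0 := by positivity
  rw [← Real.rpow_mul ha, show 4 / (n : ℝ) * (n / 4) = 1 by field_simp, Real.rpow_one]

lemma rpow_div_four_rpow_four_div (hn : 0 < n) {a : ℝ} (ha : 0 ≤ a) :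
    (a ^ ((n : ℝ) / 4)) ^ (4 / (n : ℝ)) = a := by
  have : (n : ℝ) ≠ 0 := by positivity
  rw [← Real.rpow_mul ha, show (n : ℝ) / 4 * (4 / n) = 1 by field_simp, Real.rpow_one]

lemma sq_rpow_div_four {a : ℝ} (ha : 0 ≤ a) :
    (a ^ ((n : ℝ) / 4)) ^ 2 = a ^ ((n : ℝ) / 2) := by
  rw [← Real.rpow_natCast, ← Real.rpow_mul ha]
  congr 1
  push_cast
  ring

variable [MeasurableSpace M]

lemma AETensorField.mk_eq_iff {g : SymTensor n M} {h k : TensorField n M} :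
    AETensorField.mk g h = AETensorField.mk g k ↔ ∀ᵐ x ∂(volMeasure g.field), h x = k x :=
  Quotient.eq (r := aeSetoid g)

lemma memLp_rpow_div_four {g : SymTensor n M} {ρ : M → ℝ}
    (hρ : AEMeasurable ρ (volMeasure g.field)) (hρ0 : ∀ᵐ x ∂(volMeasure g.field), 0 ≤ ρ x)
    (hfin : ∫⁻ x, ENNReal.ofReal (ρ x ^ ((n : ℝ) / 2)) ∂(volMeasure g.field) < (⊤ : ENNReal)) :
    MemLp (fun x => ρ x ^ ((n : ℝ) / 4)) 2 (volMeasure g.field) := by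
  rw [memLp_two_iff_integrable_sq (hρ.pow_const _).aestronglyMeasurable]
  have h1 : Integrable (fun x => ρ x ^ ((n : ℝ) / 2)) (volMeasure g.field) :=
    (lintegral_ofReal_ne_top_iff_integrable (hρ.pow_const _).aestronglyMeasurable
      (hρ0.mono fun x hx => Real.rpow_nonneg hx _)).1 hfin.ne
  exact h1.congr (hρ0.mono fun x hx => (sq_rpow_div_four hx).symm)

lemma expDomain_nonneg (hn : 0 < n) {g : SymTensor n M} {lam : Lp ℝ 2 (volMeasure g.field)}
    (hlam : lam ∈ expDomain g) :
    ∀ᵐ x ∂(volMeasure g.field), 0 ≤ 1 + (n : ℝ) / 4 * lam x := by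
  filter_upwards [hlam] with x hx
  have h0 : (0 : ℝ) < n := by exact_mod_cast hn
  have h1 : (n : ℝ) / 4 * -(4 / n) = -1 := by field_simp
  have h2 := mul_le_mul_of_nonneg_left hx (show 0 ≤ (n : ℝ) / 4 by positivity)
  linarith

lemma expChart_eq_of_ae (hn : 0 < n) {g : SymTensor n M} {ρ : M → ℝ}
    (hρ0 : ∀ᵐ x ∂(volMeasure g.field), 0 ≤ ρ x) {lam : Lp ℝ 2 (volMeasure g.field)}
    (hlam : ∀ᵐ x ∂(volMeasure g.field), lam x = 4 / (n : ℝ) * (ρ x ^ ((n : ℝ) / 4) - 1)) :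
    lam ∈ expDomain g ∧ expChart g lam = AETensorField.mk g (conf ρ g) := by
  have h0 : (0 : ℝ) < n := by exact_mod_cast hn
  refine ⟨?_, AETensorField.mk_eq_iff.2 ?_⟩
  · filter_upwards [hρ0, hlam] with x hx h1
    rw [h1]
    have := mul_nonneg (show 0 ≤ 4 / (n : ℝ) by positivity)
      (Real.rpow_nonneg hx ((n : ℝ) / 4))
    linarith
  · filter_upwards [hρ0, hlam] with x hx h1
    have : 1 + (n : ℝ) / 4 * lam x = ρ x ^ ((n : ℝ) / 4) := by
      rw [h1]; field_simp; ring
    simp only [conf, this, rpow_div_four_rpow_four_div hn hx]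

lemma injOn_expChart (hn : 0 < n) {g : SymTensor n M} (hg : g ∈ riemMetrics n M) :
    InjOn (expChart g) (expDomain g) := by
  intro l1 h1 l2 h2 h
  have h0 : (0 : ℝ) < n := by exact_mod_cast hn
  refine Lp.ext ?_
  filter_upwards [AETensorField.mk_eq_iff.1 h, expDomain_nonneg hn h1, expDomain_nonneg hn h2]
    with x hx hp1 hp2
  have h3 := congrArg (fun a : ℝ => a ^ ((n : ℝ) / 4)) (smul_field_injective hn hg hx)
  simp only [rpow_four_div_rpow_div_four hn hp1, rpow_four_div_rpow_div_four hn hp2] at h3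
  have h4 : (n : ℝ) / 4 * l1 x = (n : ℝ) / 4 * l2 x := by linarith
  exact mul_left_cancel₀ (by positivity) h4

variable [BorelSpace M] [CompactSpace M]

lemma volMeasure_conf_univ {g : SymTensor n M} (hg : g ∈ riemMetrics n M) {ρ : M → ℝ}
    (hρ : AEMeasurable ρ (volMeasure g.field)) (hρ0 : ∀ᵐ x ∂(volMeasure g.field), 0 ≤ ρ x) :
    volMeasure (conf ρ g) univ =
      ∫⁻ x, ENNReal.ofReal (ρ x ^ ((n : ℝ) / 2)) ∂(volMeasure g.field) := by
  rw [volMeasure_conf hg hρ hρ0, withDensity_apply _ MeasurableSet.univ, Measure.restrict_univ]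

lemma finiteVolumeConformal_eq {g : SymTensor n M} (hg : g ∈ riemMetrics n M) :
    finiteVolumeConformal g = integrableConformal g := by
  ext T
  refine exists_congr fun ρ => and_congr_right fun h1 => and_congr_right fun h2 => ?_
  rw [volMeasure_conf_univ hg h1 h2]

lemma bijOn_expChart (hn : 0 < n) {g : SymTensor n M} (hg : g ∈ riemMetrics n M) :
    BijOn (expChart g) (expDomain g) (finiteVolumeConformal g) := by
  have := isFiniteMeasure_volMeasure g
  rw [finiteVolumeConformal_eq hg]
  refine ⟨fun lam hlam => ?_, injOn_expChart hn hg, ?_⟩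
  · have hm : MemLp (fun x => 1 + (n : ℝ) / 4 * lam x) 2 (volMeasure g.field) :=
      memLp_const_add_const_mul (Lp.memLp lam) 1 _
    have hpos := expDomain_nonneg hn hlam
    refine ⟨_, hm.1.aemeasurable.pow_const _, hpos.mono fun x hx => Real.rpow_nonneg hx _, ?_, rfl⟩
    refine lt_of_eq_of_lt (lintegral_congr_ae ?_) hm.integrable_sq.lintegral_lt_top
    filter_upwards [hpos] with x hx
    rw [← sq_rpow_div_four (Real.rpow_nonneg hx _), rpow_four_div_rpow_div_four hn hx]
  · rintro T ⟨ρ, hρ, hρ0, hfin, rfl⟩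
    have hm := ((memLp_rpow_div_four hρ hρ0 hfin).sub (memLp_const 1)).const_mul (4 / (n : ℝ))
    exact ⟨hm.toLp _, expChart_eq_of_ae hn hρ0 hm.coeFn_toLp⟩

end exponentialChart

/-! ### Minkowski's integral inequality in `L²` -/

section squareIntegrable

lemma norm_toLp_two {α : Type*} [MeasurableSpace α] {μ : Measure α} {f : α → ℝ}
    (hf : MemLp f 2 μ) : ‖hf.toLp f‖ = √(∫ x, f x ^ 2 ∂μ) := by
  rw [norm_eq_sqrt_real_inner (hf.toLp f), L2.inner_def]
  congr 1
  refine integral_congr_ae ?_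
  filter_upwards [hf.coeFn_toLp] with x hx
  rw [hx]
  simp [sq]

lemma integral_mul_le_sqrt {α : Type*} [MeasurableSpace α] {μ : Measure α} {f k : α → ℝ}
    (hf : MemLp f 2 μ) (hk : MemLp k 2 μ) :
    ∫ x, f x * k x ∂μ ≤ √(∫ x, f x ^ 2 ∂μ) * √(∫ x, k x ^ 2 ∂μ) := by
  have h := real_inner_le_norm (hf.toLp f) (hk.toLp k)
  rw [norm_toLp_two, norm_toLp_two, L2.inner_def] at h
  refine le_trans (le_of_eq (integral_congr_ae ?_)) h
  filter_upwards [hf.coeFn_toLp, hk.coeFn_toLp] with x hx hy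
  rw [hx, hy]
  simp [mul_comm]

lemma memLp_of_continuous {X : Type*} [TopologicalSpace X] [CompactSpace X] [MeasurableSpace X]
    [BorelSpace X] {μ : Measure X} [IsFiniteMeasure μ] {f : X → ℝ} (hf : Continuous f)
    (p : ENNReal) : MemLp f p μ := by
  obtain ⟨C, hC⟩ := isCompact_univ.exists_bound_of_continuousOn hf.continuousOn
  exact MemLp.of_bound hf.measurable.aestronglyMeasurable C
    (Eventually.of_forall fun x => hC x (mem_univ x))

/-- Minkowski's integral inequality in `L²` for continuous families on a compact space. -/
lemma sqrt_integral_sq_intervalIntegral_le {X : Type*} [TopologicalSpace X] [CompactSpace X]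
    [SecondCountableTopology X] [MeasurableSpace X] [BorelSpace X] {μ : Measure X}
    [IsFiniteMeasure μ] {F : ℝ → X → ℝ} (hF : Continuous (Function.uncurry F)) {a b : ℝ}
    (hab : a ≤ b) {D : X → ℝ} (hD : Continuous D) (hDF : ∀ x, D x = ∫ t in a..b, F t x) :
    √(∫ x, D x ^ 2 ∂μ) ≤ ∫ t in a..b, √(∫ x, F t x ^ 2 ∂μ) := by
  set N := √(∫ x, D x ^ 2 ∂μ) with hN
  have hN0 : 0 ≤ N := Real.sqrt_nonneg _
  have hFt : ∀ t, Continuous (F t) := fun t => hF.comp (Continuous.prodMk_right t)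
  have hcont : ∀ k : ℝ → X → ℝ, Continuous (Function.uncurry k) →
      Continuous fun t => ∫ x, k t x ∂μ := by
    intro k hk
    have := continuous_parametric_integral_of_continuous (μ := μ) hk isCompact_univ
    simpa using this
  have hDFc : Continuous (Function.uncurry fun t x => D x * F t x) :=
    (hD.comp continuous_snd).mul hF
  have hF2 : Continuous (Function.uncurry fun t x => F t x ^ 2) := hF.pow 2
  have hint : Integrable (Function.uncurry fun t x => D x * F t x)
      ((volume.restrict (Set.uIoc a b)).prod μ) := by
    obtain ⟨C, hC⟩ := ((isCompact_uIcc (a := a) (b := b)).prod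
      (isCompact_univ (X := X))).exists_bound_of_continuousOn hDFc.continuousOn
    have : IsFiniteMeasure (volume.restrict (Set.uIoc a b)) := by
      rw [uIoc_of_le hab]; infer_instance
    refine Integrable.of_bound hDFc.measurable.aestronglyMeasurable C ?_
    have h1 : ∀ᵐ p ∂((volume.restrict (Set.uIoc a b)).prod μ), p.1 ∈ Set.uIoc a b :=
      Measure.quasiMeasurePreserving_fst.ae (ae_restrict_mem measurableSet_uIoc)
    filter_upwards [h1] with p hp
    exact hC p ⟨uIoc_subset_uIcc hp, mem_univ _⟩
  -- one factor of `D²` is written as a time integral, to apply Cauchy-Schwarz at each time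
  have h1 : N ^ 2 = ∫ t in a..b, ∫ x, D x * F t x ∂μ := by
    rw [intervalIntegral_integral_swap hint, hN,
      Real.sq_sqrt (integral_nonneg fun x => sq_nonneg _)]
    refine integral_congr_ae (Eventually.of_forall fun x => ?_)
    simp only
    rw [intervalIntegral.integral_const_mul, ← hDF, sq]
  have h2 : N ^ 2 ≤ N * ∫ t in a..b, √(∫ x, F t x ^ 2 ∂μ) := by
    rw [h1, ← intervalIntegral.integral_const_mul]
    refine intervalIntegral.integral_mono_on hab ((hcont _ hDFc).intervalIntegrable _ _)
      ((continuous_const.mul (hcont _ hF2).sqrt).intervalIntegrable _ _) fun t _ => ?_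
    exact integral_mul_le_sqrt (memLp_of_continuous hD 2) (memLp_of_continuous (hFt t) 2)
  rcases hN0.eq_or_lt with h0 | h0
  · rw [← h0]
    exact intervalIntegral.integral_nonneg hab fun _ _ => Real.sqrt_nonneg _
  · rw [sq] at h2
    exact le_of_mul_le_mul_left h2 h0

end squareIntegrable

/-! ### Joint continuity of conformal factors along paths -/

section smoothConvergence

lemma tendsto_prod_of_tendstoLocallyUniformlyOn {ι X : Type*} [TopologicalSpace X]
    {F : ι → X → ℝ} {f : X → ℝ} {l : Filter ι} {s : Set X}
    (h : TendstoLocallyUniformlyOn F f l s) (hf : ContinuousOn f s) {u : X} (hu : u ∈ s) :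
    Tendsto (fun p : ι × X => F p.1 p.2) (l ×ˢ 𝓝[s] u) (𝓝 (f u)) := by
  have h3 : TendstoLocallyUniformlyOn (fun p : ι × X => F p.1) f (l ×ˢ 𝓝[s] u) s :=
    fun v hv x hx => by
      obtain ⟨t, ht, h3⟩ := h v hv x hx
      exact ⟨t, ht, tendsto_fst.eventually h3⟩
  exact tendsto_comp_of_locally_uniform_limit_within (hf u hu) tendsto_snd
    (fun v hv => h3 v hv u hu)

lemma tendsto_apply_of_tendsto_prod {ι X : Type*} [TopologicalSpace X] {F : ι × X → ℝ} {c : ℝ}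
    {l : Filter ι} {s : Set X} {u : X} (hu : u ∈ s) (h : Tendsto F (l ×ˢ 𝓝[s] u) (𝓝 c)) :
    Tendsto (fun i => F (i, u)) l (𝓝 c) :=
  h.comp (tendsto_id.prodMk (tendsto_const_pure.mono_right (pure_le_nhdsWithin hu)))

/-- A family of functions whose difference quotients in time converge jointly in time and space is
jointly continuous. -/
lemma tendsto_prod_of_slope {X : Type*} [TopologicalSpace X] {F : ℝ → X → ℝ} {S : Set ℝ}
    {s : Set X} {t c : ℝ} {u : X} (hc : Tendsto (F t) (𝓝[s] u) (𝓝 (F t u)))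
    (h : Tendsto (fun p : ℝ × X => (p.1 - t)⁻¹ * (F p.1 p.2 - F t p.2))
      (𝓝[S \ {t}] t ×ˢ 𝓝[s] u) (𝓝 c)) :
    Tendsto (fun p : ℝ × X => F p.1 p.2) (𝓝[S] t ×ˢ 𝓝[s] u) (𝓝 (F t u)) := by
  -- the increment is the time increment times the difference quotient
  have h2 : Tendsto (fun p : ℝ × X => F p.1 p.2) (𝓝[S \ {t}] t ×ˢ 𝓝[s] u) (𝓝 (F t u)) := by
    have hs : Tendsto (fun p : ℝ × X => p.1 - t) (𝓝[S \ {t}] t ×ˢ 𝓝[s] u) (𝓝 0) := by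
      have : Tendsto (fun r : ℝ => r - t) (𝓝[S \ {t}] t) (𝓝 0) := by
        have h := ((continuous_id.sub continuous_const).tendsto t (f := fun r : ℝ => r - t))
        rw [sub_self] at h
        exact h.mono_left nhdsWithin_le_nhds
      exact this.comp tendsto_fst
    have h3 := (hc.comp tendsto_snd).add (hs.mul h)
    rw [zero_mul, add_zero] at h3
    refine h3.congr' ?_
    filter_upwards [tendsto_fst.eventually (self_mem_nhdsWithin (a := t) (s := S \ {t}))]
      with p hp
    have h0 : p.1 - t ≠ 0 := sub_ne_zero.2 hp.2
    simp only [Function.comp]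
    field_simp
    ring
  have h3 : Tendsto (fun p : ℝ × X => F p.1 p.2) (pure t ×ˢ 𝓝[s] u) (𝓝 (F t u)) := by
    rw [pure_prod, tendsto_map'_iff]
    exact hc
  have h4 : 𝓝[S] t ≤ 𝓝[S \ {t}] t ⊔ pure t := by
    rw [← nhdsWithin_singleton, ← nhdsWithin_union]
    exact nhdsWithin_mono _ (by simp)
  refine Tendsto.mono_left ?_ (prod_mono h4 le_rfl)
  rw [sup_prod]
  exact h2.sup h3

/-- A function on `ℝ × M` is continuous if, locally in a chart, it is a quotient of continuous
functions of the coordinates. -/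
lemma continuousOn_of_chart_quotient {X E : Type*} [TopologicalSpace X] [TopologicalSpace E]
    {S : Set ℝ} (e : OpenPartialHomeomorph X E) {C : ℝ → E → ℝ} {G : E → ℝ} {r : ℝ → X → ℝ}
    (hC : ContinuousOn (fun p : ℝ × E => C p.1 p.2) (S ×ˢ e.target))
    (hG : ContinuousOn G e.target) (hG0 : ∀ u ∈ e.target, G u ≠ 0)
    (hr : ∀ t ∈ S, ∀ u ∈ e.target, C t u = r t (e.symm u) * G u) :
    ContinuousOn (Function.uncurry r) (S ×ˢ e.source) := by
  have hmaps : MapsTo (fun p : ℝ × X => (p.1, e p.2)) (S ×ˢ e.source) (S ×ˢ e.target) :=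
    fun p hp => ⟨hp.1, e.map_source hp.2⟩
  have hm : ContinuousOn (fun p : ℝ × X => (p.1, e p.2)) (S ×ˢ e.source) :=
    continuousOn_fst.prodMk (e.continuousOn.comp continuousOn_snd fun p hp => hp.2)
  have hq : ContinuousOn (fun p : ℝ × E => C p.1 p.2 / G p.2) (S ×ˢ e.target) :=
    hC.div (hG.comp continuousOn_snd fun p hp => hp.2) fun p hp => hG0 _ hp.2
  refine (hq.comp hm hmaps).congr fun p hp => ?_
  have h1 := hr p.1 hp.1 (e p.2) (e.map_source hp.2)
  rw [e.left_inv hp.2] at h1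
  simp only [Function.uncurry, Function.comp]
  rw [h1, mul_div_cancel_right₀ _ (hG0 _ (e.map_source hp.2))]

variable {n : ℕ} {M : Type*} [TopologicalSpace M]
  [ChartedSpace (EuclideanSpace ℝ (Fin n)) M] [IsManifold (𝓡 n) ∞ M]

lemma TendstoSmooth.tendsto_coeff {ι : Type*} {f : ι → SymTensor n M} {l : Filter ι}
    {h : SymTensor n M} (hf : TendstoSmooth f l h)
    {e : OpenPartialHomeomorph M (EuclideanSpace ℝ (Fin n))}
    (he : e ∈ atlas (EuclideanSpace ℝ (Fin n)) M) (i j : Fin n) {u : EuclideanSpace ℝ (Fin n)}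
    (hu : u ∈ e.target) :
    Tendsto (fun p : ι × EuclideanSpace ℝ (Fin n) => coeff e (f p.1).field i j p.2)
      (l ×ˢ 𝓝[e.target] u) (𝓝 (coeff e h.field i j u)) := by
  have h1 := hf e he 0 i j
  have h2 : TendstoLocallyUniformlyOn (fun s => coeff e (f s).field i j)
      (coeff e h.field i j) l e.target := by
    rw [Metric.tendstoLocallyUniformlyOn_iff] at h1 ⊢
    intro ε hε x hx
    obtain ⟨t, ht, h3⟩ := h1 ε hε x hx
    refine ⟨t, ht, h3.mono fun s hs y hy => ?_⟩
    have h4 := hs y hy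
    simpa only [iteratedFDeriv_zero_eq_comp, Function.comp, LinearIsometryEquiv.dist_map] using h4
  exact tendsto_prod_of_tendstoLocallyUniformlyOn h2 (contDiffOn_coeff he h i j).continuousOn hu

lemma TendstoSmooth.tendsto_coeff_apply {ι : Type*} {f : ι → SymTensor n M} {l : Filter ι}
    {h : SymTensor n M} (hf : TendstoSmooth f l h)
    {e : OpenPartialHomeomorph M (EuclideanSpace ℝ (Fin n))}
    (he : e ∈ atlas (EuclideanSpace ℝ (Fin n)) M) (i j : Fin n) {u : EuclideanSpace ℝ (Fin n)}
    (hu : u ∈ e.target) :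
    Tendsto (fun s => coeff e (f s).field i j u) l (𝓝 (coeff e h.field i j u)) := by
  exact tendsto_apply_of_tendsto_prod hu (hf.tendsto_coeff he i j hu)

/-- The velocity of a `C¹` path has coefficients that are jointly continuous in time and space. -/
lemma C1Path.continuousOn_coeff_vel {N : Set (SymTensor n M)} {x y : SymTensor n M}
    (α : C1Path N x y) {e : OpenPartialHomeomorph M (EuclideanSpace ℝ (Fin n))}
    (he : e ∈ atlas (EuclideanSpace ℝ (Fin n)) M) (i j : Fin n) :
    ContinuousOn (fun p : ℝ × EuclideanSpace ℝ (Fin n) => coeff e (α.vel p.1).field i j p.2)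
      (Icc α.a α.b ×ˢ e.target) := by
  rintro ⟨t, u⟩ ⟨ht, hu⟩
  rw [ContinuousWithinAt, nhdsWithin_prod_eq]
  exact (α.cont_vel t ht).tendsto_coeff he i j hu

/-- A `C¹` path has coefficients that are jointly continuous in time and space. -/
lemma C1Path.continuousOn_coeff_path {N : Set (SymTensor n M)} {x y : SymTensor n M}
    (α : C1Path N x y) {e : OpenPartialHomeomorph M (EuclideanSpace ℝ (Fin n))}
    (he : e ∈ atlas (EuclideanSpace ℝ (Fin n)) M) (i j : Fin n) :
    ContinuousOn (fun p : ℝ × EuclideanSpace ℝ (Fin n) => coeff e (α.path p.1).field i j p.2)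
      (Icc α.a α.b ×ˢ e.target) := by
  rintro ⟨t, u⟩ ⟨ht, hu⟩
  rw [ContinuousWithinAt, nhdsWithin_prod_eq]
  have hc : Tendsto (fun v => coeff e (α.path t).field i j v) (𝓝[e.target] u)
      (𝓝 (coeff e (α.path t).field i j u)) := (contDiffOn_coeff he _ i j).continuousOn u hu
  exact tendsto_prod_of_slope (F := fun s v => coeff e (α.path s).field i j v) hc
    ((α.hasDeriv t ht).tendsto_coeff he i j hu)

/-- If tensor fields are conformal to `g` and have jointly continuous coefficients in all charts,
then the conformal factors are jointly continuous. -/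
lemma continuousOn_conformalFactor (hn : 0 < n) {g : SymTensor n M} (hg : g ∈ riemMetrics n M)
    {h : ℝ → SymTensor n M} {r : ℝ → M → ℝ} {S : Set ℝ}
    (hr : ∀ t ∈ S, ∀ x, (h t).field x = r t x • g.field x)
    (hc : ∀ e ∈ atlas (EuclideanSpace ℝ (Fin n)) M, ∀ i j : Fin n,
      ContinuousOn (fun p : ℝ × EuclideanSpace ℝ (Fin n) => coeff e (h p.1).field i j p.2)
        (S ×ˢ e.target)) :
    ContinuousOn (Function.uncurry r) (S ×ˢ univ) := by
  rintro ⟨t, x⟩ ⟨ht, -⟩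
  set e := chartAt (EuclideanSpace ℝ (Fin n)) x with he
  have hea : e ∈ atlas (EuclideanSpace ℝ (Fin n)) M := chart_mem_atlas _ x
  have hx : x ∈ e.source := mem_chart_source _ x
  set i : Fin n := ⟨0, hn⟩
  have h2 : ContinuousOn (Function.uncurry r) (S ×ˢ e.source) := by
    refine continuousOn_of_chart_quotient e (C := fun s u => coeff e (h s).field i i u)
      (G := coeff e g.field i i) (hc e hea i i) (contDiffOn_coeff hea g i i).continuousOn
      (fun u hu => (coeff_self_pos hg hea hu i).ne') fun s hs u hu => ?_
    simp only [coeff]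
    rw [hr s hs]
    rfl
  refine (h2 (t, x) ⟨ht, hx⟩).mono_of_mem_nhdsWithin ?_
  rw [nhdsWithin_prod_eq]
  refine prod_mem_prod self_mem_nhdsWithin ?_
  rw [nhdsWithin_univ]
  exact e.open_source.mem_nhds hx

end smoothConvergence

/-! ### Length of a path of positive functions -/

section pathLength

/-- The `L²` length of a path of positive functions, in the metric for which `ρ ↦ ρ^κ / κ` is an
isometry, is at least the distance of the endpoints. -/
lemma sqrt_integral_rpow_sub_le {X : Type*} [TopologicalSpace X] [CompactSpace X]
    [SecondCountableTopology X] [MeasurableSpace X] [BorelSpace X] {μ : Measure X}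
    [IsFiniteMeasure μ] {ρ σ : ℝ → X → ℝ} {a b : ℝ} (hab : a ≤ b) {κ : ℝ} (hκ : κ ≠ 0)
    (hρ : ContinuousOn (Function.uncurry ρ) (Icc a b ×ˢ univ))
    (hσ : ContinuousOn (Function.uncurry σ) (Icc a b ×ˢ univ))
    (hpos : ∀ t ∈ Icc a b, ∀ p, 0 < ρ t p)
    (hder : ∀ t ∈ Icc a b, ∀ p, HasDerivWithinAt (fun s => ρ s p) (σ t p) (Icc a b) t) :
    √(∫ p, (κ⁻¹ * (ρ b p ^ κ - ρ a p ^ κ)) ^ 2 ∂μ) ≤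
      ∫ t in a..b, √(∫ p, (ρ t p ^ (κ - 1) * σ t p) ^ 2 ∂μ) := by
  -- the time derivative of `ρ^κ / κ`, extended to all times
  set F : ℝ → X → ℝ := fun t p =>
    ρ (projIcc a b hab t) p ^ (κ - 1) * σ (projIcc a b hab t) p with hF
  have hm : Continuous fun q : ℝ × X => ((projIcc a b hab q.1 : ℝ), q.2) :=
    (continuous_subtype_val.comp (continuous_projIcc.comp continuous_fst)).prodMk continuous_snd
  have hmm : ∀ q : ℝ × X, ((projIcc a b hab q.1 : ℝ), q.2) ∈ Icc a b ×ˢ (univ : Set X) :=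
    fun q => ⟨(projIcc a b hab q.1).2, mem_univ _⟩
  have hFc : Continuous (Function.uncurry F) := by
    have h1 := hρ.comp_continuous hm hmm
    have h2 := hσ.comp_continuous hm hmm
    exact (h1.rpow_const fun q => Or.inl (hpos _ (hmm q).1 q.2).ne').mul h2
  have hFI : ∀ t ∈ Icc a b, ∀ p, F t p = ρ t p ^ (κ - 1) * σ t p := by
    intro t ht p
    simp only [hF, projIcc_of_mem hab ht]
  have hder' : ∀ p, ∀ t ∈ Icc a b,
      HasDerivWithinAt (fun s => κ⁻¹ * ρ s p ^ κ) (F t p) (Icc a b) t := by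
    intro p t ht
    have h2 := ((hder t ht p).rpow_const (p := κ) (Or.inl (hpos t ht p).ne')).const_mul κ⁻¹
    rw [hFI t ht p]
    exact h2.congr_deriv (by field_simp)
  have hD : ∀ p, κ⁻¹ * (ρ b p ^ κ - ρ a p ^ κ) = ∫ t in a..b, F t p := by
    intro p
    have hFp : Continuous fun t => F t p := hFc.comp (Continuous.prodMk_left p)
    rw [intervalIntegral.integral_eq_sub_of_hasDeriv_right_of_le hab
      (f := fun s => κ⁻¹ * ρ s p ^ κ)
      (fun t ht => (hder' p t ht).continuousWithinAt)
      (fun t ht => ((hder' p t (Ioo_subset_Icc_self ht)).hasDerivAt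
        (Icc_mem_nhds ht.1 ht.2)).hasDerivWithinAt) (hFp.intervalIntegrable _ _), mul_sub]
  have hslice : ∀ t ∈ Icc a b, Continuous fun p => κ⁻¹ * ρ t p ^ κ := by
    intro t ht
    have h1 : Continuous fun p => ρ t p :=
      hρ.comp_continuous (Continuous.prodMk_right t) fun p => ⟨ht, mem_univ p⟩
    exact continuous_const.mul (h1.rpow_const fun p => Or.inl (hpos t ht p).ne')
  have hDc : Continuous fun p => κ⁻¹ * (ρ b p ^ κ - ρ a p ^ κ) := by
    simp only [mul_sub]
    exact (hslice b (right_mem_Icc.2 hab)).sub (hslice a (left_mem_Icc.2 hab))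
  refine (sqrt_integral_sq_intervalIntegral_le (μ := μ) hFc hab hDc hD).trans_eq ?_
  refine intervalIntegral.integral_congr fun t ht => ?_
  rw [uIcc_of_le hab] at ht
  simp only [hFI t ht]

end pathLength

/-! ### Paths in the conformal orbit -/

section conformalFactor
variable {n : ℕ} {M : Type*} [TopologicalSpace M]
  [ChartedSpace (EuclideanSpace ℝ (Fin n)) M] [IsManifold (𝓡 n) ∞ M]

/-- The function `tr (g⁻¹ h) / n`, which recovers `ρ` from `h = ρ g`. -/
def conformalFactor (g h : SymTensor n M) (x : M) : ℝ :=
  ((formMatrix x (g.field x))⁻¹ * formMatrix x (h.field x)).trace / n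

lemma conformalFactor_eq (hn : 0 < n) {g : SymTensor n M} (hg : g ∈ riemMetrics n M)
    {h : SymTensor n M} {x : M} {r : ℝ} (hh : h.field x = r • g.field x) :
    conformalFactor g h x = r := by
  have h2 : formMatrix x (h.field x) = r • formMatrix x (g.field x) := by rw [hh]; rfl
  have hu : IsUnit (formMatrix x (g.field x)).det := (formMatrix_posDef hg x).det_pos.ne'.isUnit
  have h0 : (n : ℝ) ≠ 0 := by positivity
  rw [conformalFactor, h2, Matrix.mul_smul, Matrix.nonsing_inv_mul _ hu, Matrix.trace_smul,
    Matrix.trace_one, Fintype.card_fin, smul_eq_mul, mul_div_cancel_right₀ _ h0]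

lemma contMDiff_conformalFactor (hn : 0 < n) {g : SymTensor n M} (hg : g ∈ riemMetrics n M)
    {h : SymTensor n M} (hh : h ∈ conformalOrbit g) :
    ContMDiff (𝓡 n) 𝓘(ℝ, ℝ) ∞ (conformalFactor g h) := by
  obtain ⟨ρ, h1, h2, h3⟩ := hh
  rwa [show conformalFactor g h = ρ from funext fun x => conformalFactor_eq hn hg (h3 x)]

lemma conformalFactor_pos (hn : 0 < n) {g : SymTensor n M} (hg : g ∈ riemMetrics n M)
    {h : SymTensor n M} (hh : h ∈ conformalOrbit g) (x : M) : 0 < conformalFactor g h x := by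
  obtain ⟨ρ, h1, h2, h3⟩ := hh
  rw [conformalFactor_eq hn hg (h3 x)]
  exact h2 x

lemma field_eq_conformalFactor_smul (hn : 0 < n) {g : SymTensor n M} (hg : g ∈ riemMetrics n M)
    {h : SymTensor n M} (hh : h ∈ conformalOrbit g) (x : M) :
    h.field x = conformalFactor g h x • g.field x := by
  obtain ⟨ρ, h1, h2, h3⟩ := hh
  rw [conformalFactor_eq hn hg (h3 x)]
  exact h3 x

/-- The coordinate `ψ⁻¹ (ρ g) = (4/n) (ρ^(n/4) - 1)` of a point `ρ g` of the conformal orbit. -/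
def orbitCoord (g h : SymTensor n M) (x : M) : ℝ :=
  4 / (n : ℝ) * (conformalFactor g h x ^ ((n : ℝ) / 4) - 1)

lemma continuous_orbitCoord (hn : 0 < n) {g : SymTensor n M} (hg : g ∈ riemMetrics n M)
    {h : SymTensor n M} (hh : h ∈ conformalOrbit g) : Continuous (orbitCoord g h) := by
  have h1 := (contMDiff_conformalFactor hn hg hh).continuous
  have h2 := fun x => (conformalFactor_pos hn hg hh x).ne'
  exact continuous_const.mul ((h1.rpow_const fun x => Or.inl (h2 x)).sub continuous_const)

/-- The multiple `ρ g`, for a smooth function `ρ`, of a smooth symmetric tensor field. -/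
def SymTensor.conf (g : SymTensor n M) (ρ : M → ℝ) (hρ : ContMDiff (𝓡 n) 𝓘(ℝ, ℝ) ∞ ρ) :
    SymTensor n M :=
  ⟨⟨fun x => ρ x • g.1 x, hρ.smul_section g.1.contMDiff⟩, fun x v w => by
    have h1 := g.2 x v w
    show ρ x • g.1 x v w = ρ x • g.1 x w v
    rw [h1]⟩

/-- The velocity of a `C¹` path in the conformal orbit is again conformal to `g`, and its factor is
the time derivative of the factor of the path. -/
lemma C1Path.exists_conformal_vel (hn : 0 < n) {g : SymTensor n M} (hg : g ∈ riemMetrics n M)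
    {x y : SymTensor n M} (α : C1Path (conformalOrbit g) x y) (hab : α.a < α.b) {t : ℝ}
    (ht : t ∈ Icc α.a α.b) (p : M) :
    (α.vel t).field p = conformalFactor g (α.vel t) p • g.field p ∧
      HasDerivWithinAt (fun s => conformalFactor g (α.path s) p)
        (conformalFactor g (α.vel t) p) (Icc α.a α.b) t := by
  suffices h : ∃ σ : ℝ, (α.vel t).field p = σ • g.field p ∧
      HasDerivWithinAt (fun s => conformalFactor g (α.path s) p) σ (Icc α.a α.b) t by
    obtain ⟨σ, h1, h2⟩ := h
    rw [conformalFactor_eq hn hg h1]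
    exact ⟨h1, h2⟩
  obtain ⟨e, he, u, hu, rfl⟩ : ∃ e ∈ atlas (EuclideanSpace ℝ (Fin n)) M, ∃ u ∈ e.target,
      e.symm u = p :=
    ⟨chartAt _ p, chart_mem_atlas _ p, _, (chartAt _ p).map_source (mem_chart_source _ p),
      (chartAt _ p).left_inv (mem_chart_source _ p)⟩
  have hne : (𝓝[Icc α.a α.b \ {t}] t).NeBot :=
    accPt_principal_iff_nhdsWithin.1 ((uniqueDiffOn_Icc hab t ht).accPt)
  -- the difference quotient of the factor is read off from one diagonal coefficient in a chart
  set q : ℝ → ℝ := fun s => (s - t)⁻¹ *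
    (conformalFactor g (α.path s) (e.symm u) - conformalFactor g (α.path t) (e.symm u)) with hq
  have hlim : ∀ i j, Tendsto (fun s => q s * coeff e g.field i j u) (𝓝[Icc α.a α.b \ {t}] t)
      (𝓝 (coeff e (α.vel t).field i j u)) := by
    intro i j
    refine ((α.hasDeriv t ht).tendsto_coeff_apply he i j hu).congr' ?_
    filter_upwards [self_mem_nhdsWithin] with s hs
    have h1 : coeff e ((s - t)⁻¹ • (α.path s - α.path t)).field i j u =
      (s - t)⁻¹ * (coeff e (α.path s).field i j u - coeff e (α.path t).field i j u) := rfl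
    have h2 : ∀ r ∈ Icc α.a α.b, coeff e (α.path r).field i j u =
        conformalFactor g (α.path r) (e.symm u) * coeff e g.field i j u := by
      intro r hr
      have := field_eq_conformalFactor_smul hn hg (α.mem r hr) (e.symm u)
      simp only [coeff]
      rw [this]
      rfl
    rw [h1, h2 s hs.1, h2 t ht, hq]
    ring
  have hg0 := (coeff_self_pos hg he hu ⟨0, hn⟩).ne'
  set σ : ℝ := coeff e (α.vel t).field ⟨0, hn⟩ ⟨0, hn⟩ u / coeff e g.field ⟨0, hn⟩ ⟨0, hn⟩ u
  have hqσ : Tendsto q (𝓝[Icc α.a α.b \ {t}] t) (𝓝 σ) := by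
    refine ((hlim ⟨0, hn⟩ ⟨0, hn⟩).div_const (coeff e g.field ⟨0, hn⟩ ⟨0, hn⟩ u)).congr fun s => ?_
    rw [mul_div_cancel_right₀ _ hg0]
  refine ⟨σ, ?_, ?_⟩
  · have h1 : ∀ i j, coeff e (α.vel t).field i j u = σ * coeff e g.field i j u := fun i j =>
      tendsto_nhds_unique (hlim i j) (hqσ.mul_const _)
    refine ContinuousLinearMap.ext fun v => ContinuousLinearMap.ext fun w => ?_
    obtain ⟨c, d, hcd⟩ := form_apply_eq_sum_coeff he hu v w
    show (α.vel t).field (e.symm u) v w = σ * g.field (e.symm u) v w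
    rw [hcd, hcd]
    simp only [h1, Finset.mul_sum]
    exact Finset.sum_congr rfl fun i _ => Finset.sum_congr rfl fun j _ => by ring
  · rw [hasDerivWithinAt_iff_tendsto_slope]
    exact hqσ

/-- The factors of a `C¹` path in the conformal orbit and of its velocity are jointly continuous. -/
lemma C1Path.continuousOn_conformalFactor (hn : 0 < n) {g : SymTensor n M}
    (hg : g ∈ riemMetrics n M) {x y : SymTensor n M} (α : C1Path (conformalOrbit g) x y)
    (hab : α.a < α.b) :
    ContinuousOn (Function.uncurry fun t => conformalFactor g (α.path t))
        (Icc α.a α.b ×ˢ univ) ∧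
      ContinuousOn (Function.uncurry fun t => conformalFactor g (α.vel t))
        (Icc α.a α.b ×ˢ univ) := by
  constructor
  · exact _root_.continuousOn_conformalFactor hn hg
      (fun t ht x => field_eq_conformalFactor_smul hn hg (α.mem t ht) x)
      fun e he i j => α.continuousOn_coeff_path he i j
  · exact _root_.continuousOn_conformalFactor hn hg
      (fun t ht x => (α.exists_conformal_vel hn hg hab ht x).1)
      fun e he i j => α.continuousOn_coeff_vel he i j

variable [CompactSpace M] [MeasurableSpace M] [BorelSpace M]

/-- A `C¹` path in the conformal orbit is at least as long as the straight segment between the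
coordinates of its endpoints. -/
lemma C1Path.sqrt_mul_le_length (hn : 0 < n) {g : SymTensor n M}
    (hg : g ∈ riemMetrics n M) {x y : SymTensor n M} (α : C1Path (conformalOrbit g) x y) :
    √(n : ℝ) * √(∫ p, (orbitCoord g y p - orbitCoord g x p) ^ 2 ∂(volMeasure g.field)) ≤
      α.length := by
  have hfin := isFiniteMeasure_volMeasure g
  rcases α.a_le_b.eq_or_lt with hab | hab
  · have : x = y := α.source.symm.trans ((congrArg α.path hab).trans α.target)
    subst this
    simpa using α.length_nonneg
  have hsc : SecondCountableTopology M :=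
    ChartedSpace.secondCountable_of_sigmaCompact (EuclideanSpace ℝ (Fin n)) M
  have hn4 : (n : ℝ) / 4 ≠ 0 := by positivity
  obtain ⟨hρ, hσ⟩ := α.continuousOn_conformalFactor hn hg hab
  have hpos : ∀ t ∈ Icc α.a α.b, ∀ p, 0 < conformalFactor g (α.path t) p :=
    fun t ht p => conformalFactor_pos hn hg (α.mem t ht) p
  have hmink := sqrt_integral_rpow_sub_le (μ := volMeasure g.field) hab.le hn4 hρ hσ hpos
    fun t ht p => (α.exists_conformal_vel hn hg hab ht p).2
  have hlen : α.length = √(n : ℝ) * ∫ t in α.a..α.b,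
      √(∫ p, (conformalFactor g (α.path t) p ^ ((n : ℝ) / 4 - 1) *
        conformalFactor g (α.vel t) p) ^ 2 ∂(volMeasure g.field)) := by
    rw [C1Path.length, ← intervalIntegral.integral_const_mul]
    refine intervalIntegral.integral_congr fun t ht => ?_
    rw [uIcc_of_le hab.le] at ht
    rw [l2Metric_conf hg (contMDiff_conformalFactor hn hg (α.mem t ht)).continuous (hpos t ht)
      (field_eq_conformalFactor_smul hn hg (α.mem t ht))
      (fun p => (α.exists_conformal_vel hn hg hab ht p).1), Real.sqrt_mul (Nat.cast_nonneg n)]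
  rw [α.source, α.target] at hmink
  rw [hlen]
  refine mul_le_mul_of_nonneg_left (le_of_eq_of_le ?_ hmink) (Real.sqrt_nonneg _)
  congr 1
  refine integral_congr_ae (Eventually.of_forall fun p => ?_)
  simp only [orbitCoord, inv_div]
  ring

end conformalFactor

/-! ### The distance in the orbit: nearby points -/

section orbitDistance

/-- Comparison of the infinitesimal and the finite increments of `ρ ↦ ρ^κ / κ`: on an interval whose
endpoints have ratio at most `Q`, the derivative varies by a factor at most `Q^|κ - 1|`. -/
lemma abs_rpow_sub_one_mul_sub_le {κ Q r s w : ℝ} (hκ : κ ≠ 0) (hr : 0 < r) (hs : 0 < s)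
    (hrs : s ≤ Q * r) (hsr : r ≤ Q * s) (hw : w ∈ segment ℝ r s) :
    |w ^ (κ - 1) * (s - r)| ≤ Q ^ |κ - 1| * |κ⁻¹ * (s ^ κ - r ^ κ)| := by
  wlog hle : r ≤ s generalizing r s
  · have h := this hs hr hsr hrs (segment_symm ℝ r s ▸ hw) (le_of_not_ge hle)
    rwa [← neg_sub s r, ← neg_sub (s ^ κ), mul_neg, mul_neg, abs_neg, abs_neg] at h
  rcases hle.eq_or_lt with rfl | hlt
  · simp
  rw [segment_eq_Icc hle] at hw
  -- the finite increment is the derivative at an intermediate point `ζ`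
  obtain ⟨ζ, hζ, hζ'⟩ := exists_deriv_eq_slope (fun v => κ⁻¹ * v ^ κ) hlt
    (fun v hv => (continuousAt_const.mul (Real.continuousAt_rpow_const _ _
      (Or.inl (hr.trans_le hv.1).ne'))).continuousWithinAt)
    (fun v hv => (((Real.hasDerivAt_rpow_const
      (Or.inl (hr.trans hv.1).ne')).const_mul κ⁻¹).differentiableAt).differentiableWithinAt)
  have hζ0 : 0 < ζ := hr.trans hζ.1
  have hw0 : 0 < w := hr.trans_le hw.1
  have h1 : κ⁻¹ * (s ^ κ - r ^ κ) = ζ ^ (κ - 1) * (s - r) := by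
    rw [((Real.hasDerivAt_rpow_const (Or.inl hζ0.ne')).const_mul κ⁻¹).deriv,
      eq_div_iff (sub_pos.2 hlt).ne'] at hζ'
    rw [mul_sub, ← hζ']
    field_simp
  have h2 : w ^ (κ - 1) ≤ Q ^ |κ - 1| * ζ ^ (κ - 1) := by
    rw [← div_le_iff₀ (Real.rpow_pos_of_pos hζ0 _), ← Real.div_rpow hw0.le hζ0.le]
    have hQ0 : 0 < Q := pos_of_mul_pos_left (hs.trans_le hrs) hr.le
    have hwz : w / ζ ≤ Q := by
      rw [div_le_iff₀ hζ0]
      exact hw.2.trans (hrs.trans (mul_le_mul_of_nonneg_left hζ.1.le hQ0.le))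
    have hzw : ζ / w ≤ Q := by
      rw [div_le_iff₀ hw0]
      exact hζ.2.le.trans (hrs.trans (mul_le_mul_of_nonneg_left hw.1 hQ0.le))
    rcases le_total 0 (κ - 1) with h | h
    · rw [abs_of_nonneg h]
      exact Real.rpow_le_rpow (div_pos hw0 hζ0).le hwz h
    · rw [abs_of_nonpos h, ← inv_div, Real.inv_rpow (div_pos hζ0 hw0).le,
        ← Real.rpow_neg (div_pos hζ0 hw0).le]
      exact Real.rpow_le_rpow (div_pos hζ0 hw0).le hzw (neg_nonneg.2 h)
  rw [h1, abs_mul, abs_mul, abs_of_pos (Real.rpow_pos_of_pos hw0 _),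
    abs_of_pos (Real.rpow_pos_of_pos hζ0 _), ← mul_assoc]
  exact mul_le_mul_of_nonneg_right h2 (abs_nonneg _)

variable {n : ℕ} {M : Type*} [TopologicalSpace M]
  [ChartedSpace (EuclideanSpace ℝ (Fin n)) M]

lemma contMDiff_rpow_const {f : M → ℝ} (hf : ContMDiff (𝓡 n) 𝓘(ℝ, ℝ) ∞ f) (hf0 : ∀ x, 0 < f x)
    (p : ℝ) : ContMDiff (𝓡 n) 𝓘(ℝ, ℝ) ∞ fun x => f x ^ p := fun x =>
  (Real.contDiffAt_rpow_const_of_ne (hf0 x).ne').comp_contMDiffAt (hf x)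

variable [IsManifold (𝓡 n) ∞ M]

lemma PiecewiseC1Path.mem {N : Set (SymTensor n M)} {x y : SymTensor n M}
    (α : PiecewiseC1Path N x y) : x ∈ N ∧ y ∈ N := by
  induction α with
  | single α =>
    exact ⟨α.source ▸ α.mem _ (left_mem_Icc.2 α.a_le_b),
      α.target ▸ α.mem _ (right_mem_Icc.2 α.a_le_b)⟩
  | concat α β ihα ihβ => exact ⟨ihα.1, ihβ.2⟩

lemma SymTensor.segment_field {g x y : SymTensor n M} {p : M} {a b : ℝ}
    (hx : x.field p = a • g.field p) (hy : y.field p = b • g.field p) (t : ℝ) :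
    (y - x).field p = (b - a) • g.field p ∧
      (x + t • (y - x)).field p = (a + t * (b - a)) • g.field p := by
  have hx' : ∀ v w, x.field p v w = a * g.field p v w := fun v w => by rw [hx]; rfl
  have hy' : ∀ v w, y.field p v w = b * g.field p v w := fun v w => by rw [hy]; rfl
  constructor <;> refine ContinuousLinearMap.ext fun v => ContinuousLinearMap.ext fun w => ?_
  · show y.field p v w - x.field p v w = (b - a) * g.field p v w
    rw [hx', hy']
    ring
  · show x.field p v w + t * (y.field p v w - x.field p v w) = (a + t * (b - a)) * g.field p v w
    rw [hx', hy']
    ring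

lemma conf_mem_conformalOrbit {g : SymTensor n M} {ρ : M → ℝ}
    (hρ : ContMDiff (𝓡 n) 𝓘(ℝ, ℝ) ∞ ρ) (hρ0 : ∀ x, 0 < ρ x) : g.conf ρ hρ ∈ conformalOrbit g :=
  ⟨ρ, hρ, hρ0, fun _ => rfl⟩

variable [CompactSpace M] [MeasurableSpace M] [BorelSpace M]

lemma memLp_orbitCoord (hn : 0 < n) {g : SymTensor n M} (hg : g ∈ riemMetrics n M)
    {h : SymTensor n M} (hh : h ∈ conformalOrbit g) :
    MemLp (orbitCoord g h) 2 (volMeasure g.field) := by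
  have := isFiniteMeasure_volMeasure g
  exact memLp_of_continuous (continuous_orbitCoord hn hg hh) 2

/-- The coordinate of a point of the conformal orbit, as an element of `L²(M, μ_g)`. -/
def orbitLp (hn : 0 < n) {g : SymTensor n M} (hg : g ∈ riemMetrics n M)
    (h : conformalOrbit g) : Lp ℝ 2 (volMeasure g.field) :=
  (memLp_orbitCoord hn hg h.2).toLp _

lemma norm_orbitLp_sub (hn : 0 < n) {g : SymTensor n M} (hg : g ∈ riemMetrics n M)
    (x y : conformalOrbit g) : ‖orbitLp hn hg y - orbitLp hn hg x‖ =
      √(∫ p, (orbitCoord g y.1 p - orbitCoord g x.1 p) ^ 2 ∂(volMeasure g.field)) := by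
  rw [orbitLp, orbitLp, ← MemLp.toLp_sub, norm_toLp_two]
  rfl

lemma PiecewiseC1Path.norm_orbitLp_sub_le (hn : 0 < n) {g : SymTensor n M}
    (hg : g ∈ riemMetrics n M) {x y : SymTensor n M}
    (α : PiecewiseC1Path (conformalOrbit g) x y) :
    ∀ (hx : x ∈ conformalOrbit g) (hy : y ∈ conformalOrbit g),
      √(n : ℝ) * ‖orbitLp hn hg ⟨y, hy⟩ - orbitLp hn hg ⟨x, hx⟩‖ ≤ α.length := by
  induction α with
  | single α =>
    intro hx hy
    rw [norm_orbitLp_sub]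
    exact α.sqrt_mul_le_length hn hg
  | @concat x y z α β ihα ihβ =>
    intro hx hz
    have hy := α.mem.2
    have h1 := norm_sub_le_norm_sub_add_norm_sub (orbitLp hn hg ⟨z, hz⟩) (orbitLp hn hg ⟨y, hy⟩)
      (orbitLp hn hg ⟨x, hx⟩)
    have h2 := mul_le_mul_of_nonneg_left h1 (Real.sqrt_nonneg (n : ℝ))
    have h3 : (PiecewiseC1Path.concat α β).length = α.length + β.length := rfl
    rw [h3]
    linarith [ihα hx hy, ihβ hy hz]

/-- The straight segment in the orbit is almost shortest when its endpoints have ratio close to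
one. -/
lemma pathDist_le_of_ratio (hn : 0 < n) {g : SymTensor n M} (hg : g ∈ riemMetrics n M)
    (x y : conformalOrbit g) {Q : ℝ}
    (hxy : ∀ p, conformalFactor g y.1 p ≤ Q * conformalFactor g x.1 p)
    (hyx : ∀ p, conformalFactor g x.1 p ≤ Q * conformalFactor g y.1 p) (hQ : 0 ≤ Q) :
    pathDist (conformalOrbit g) x.1 y.1 ≤
      √(n : ℝ) * (Q ^ |(n : ℝ) / 4 - 1| * ‖orbitLp hn hg y - orbitLp hn hg x‖) := by
  have hfin := isFiniteMeasure_volMeasure g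
  set α := C1Path.segment (convex_conformalOrbit g) x.2 y.2 with hα
  refine (ciInf_le (pathDist_bddBelow _ _ _) (.single α)).trans ?_
  show α.length ≤ _
  have hx := field_eq_conformalFactor_smul hn hg x.2
  have hy := field_eq_conformalFactor_smul hn hg y.2
  have hx0 := conformalFactor_pos hn hg x.2
  have hy0 := conformalFactor_pos hn hg y.2
  have hxc := (contMDiff_conformalFactor hn hg x.2).continuous
  have hyc := (contMDiff_conformalFactor hn hg y.2).continuous
  have hbound : ∀ t ∈ Set.uIoc (0 : ℝ) 1,
      ‖√(l2Metric (α.path t) (α.vel t) (α.vel t))‖ ≤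
        √(n : ℝ) * (Q ^ |(n : ℝ) / 4 - 1| * ‖orbitLp hn hg y - orbitLp hn hg x‖) := by
    intro t ht
    rw [uIoc_of_le zero_le_one] at ht
    set w : M → ℝ := fun p =>
      conformalFactor g x.1 p + t * (conformalFactor g y.1 p - conformalFactor g x.1 p) with hw
    have hwseg : ∀ p, w p ∈ segment ℝ (conformalFactor g x.1 p) (conformalFactor g y.1 p) := by
      intro p
      rw [segment_eq_image']
      exact ⟨t, ⟨ht.1.le, ht.2⟩, rfl⟩
    have hw0 : ∀ p, 0 < w p := fun p =>
      (convex_Ioi (0 : ℝ)).segment_subset (hx0 p) (hy0 p) (hwseg p)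
    have hwc : Continuous w := hxc.add (continuous_const.mul (hyc.sub hxc))
    have hvel : ∀ p, (α.vel t).field p =
        (conformalFactor g y.1 p - conformalFactor g x.1 p) • g.field p :=
      fun p => (SymTensor.segment_field (hx p) (hy p) t).1
    have hpath : ∀ p, (α.path t).field p = w p • g.field p :=
      fun p => (SymTensor.segment_field (hx p) (hy p) t).2
    rw [Real.norm_of_nonneg (Real.sqrt_nonneg _), l2Metric_conf hg hwc hw0 hpath hvel,
      Real.sqrt_mul (Nat.cast_nonneg n), norm_orbitLp_sub]
    refine mul_le_mul_of_nonneg_left ?_ (Real.sqrt_nonneg _)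
    have hQ' : 0 ≤ Q ^ |(n : ℝ) / 4 - 1| := Real.rpow_nonneg hQ _
    rw [← Real.sqrt_sq hQ', ← Real.sqrt_mul (sq_nonneg _), ← integral_const_mul]
    refine Real.sqrt_le_sqrt (integral_mono ?_ ?_ fun p => ?_)
    · refine (memLp_of_continuous (Continuous.mul ?_ (hyc.sub hxc)) 2).integrable_sq
      exact hwc.rpow_const fun p => Or.inl (hw0 p).ne'
    · refine (memLp_of_continuous (Continuous.sub ?_ ?_) 2).integrable_sq.const_mul _
      · exact continuous_orbitCoord hn hg y.2
      · exact continuous_orbitCoord hn hg x.2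
    · have h1 := abs_rpow_sub_one_mul_sub_le (κ := (n : ℝ) / 4) (by positivity) (hx0 p) (hy0 p)
        (hxy p) (hyx p) (hwseg p)
      have h2 : ((n : ℝ) / 4)⁻¹ * (conformalFactor g y.1 p ^ ((n : ℝ) / 4) -
          conformalFactor g x.1 p ^ ((n : ℝ) / 4)) = orbitCoord g y.1 p - orbitCoord g x.1 p := by
        simp only [orbitCoord, inv_div]
        ring
      rw [h2] at h1
      simp only
      rw [← mul_pow]
      refine sq_le_sq.2 (h1.trans_eq ?_)
      rw [abs_mul (_ ^ _) (_ - _), abs_of_nonneg hQ']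
  have h := intervalIntegral.norm_integral_le_of_norm_le_const hbound
  have h1 : α.length = ∫ t in (0 : ℝ)..1, √(l2Metric (α.path t) (α.vel t) (α.vel t)) := rfl
  rw [h1]
  refine (le_abs_self _).trans (h.trans_eq ?_)
  simp

end orbitDistance

/-! ### The distance in the orbit: inscribed polygons -/

section geodesics
variable {n : ℕ} {M : Type*} [TopologicalSpace M]
  [ChartedSpace (EuclideanSpace ℝ (Fin n)) M] [IsManifold (𝓡 n) ∞ M]

/-- The point `a^(4/n) g` of the conformal orbit, for a smooth positive function `a`. -/
def orbitPoint (g : SymTensor n M) (a : M → ℝ) (ha : ContMDiff (𝓡 n) 𝓘(ℝ, ℝ) ∞ a)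
    (ha0 : ∀ p, 0 < a p) : conformalOrbit g :=
  ⟨g.conf (fun p => a p ^ (4 / (n : ℝ))) (contMDiff_rpow_const ha ha0 _),
    conf_mem_conformalOrbit _ fun p => Real.rpow_pos_of_pos (ha0 p) _⟩

lemma conformalFactor_orbitPoint (hn : 0 < n) {g : SymTensor n M} (hg : g ∈ riemMetrics n M)
    {a : M → ℝ} (ha : ContMDiff (𝓡 n) 𝓘(ℝ, ℝ) ∞ a) (ha0 : ∀ p, 0 < a p) (p : M) :
    conformalFactor g (orbitPoint g a ha ha0).1 p = a p ^ (4 / (n : ℝ)) :=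
  conformalFactor_eq hn hg rfl

lemma orbitCoord_orbitPoint (hn : 0 < n) {g : SymTensor n M} (hg : g ∈ riemMetrics n M)
    {a : M → ℝ} (ha : ContMDiff (𝓡 n) 𝓘(ℝ, ℝ) ∞ a) (ha0 : ∀ p, 0 < a p) (p : M) :
    orbitCoord g (orbitPoint g a ha ha0).1 p = 4 / (n : ℝ) * (a p - 1) := by
  rw [orbitCoord, conformalFactor_orbitPoint hn hg, rpow_four_div_rpow_div_four hn (ha0 p).le]

lemma orbitPoint_eq (hn : 0 < n) {g : SymTensor n M} (hg : g ∈ riemMetrics n M)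
    (x : conformalOrbit g) {a : M → ℝ} (ha : ContMDiff (𝓡 n) 𝓘(ℝ, ℝ) ∞ a)
    (ha0 : ∀ p, 0 < a p) (h : ∀ p, a p = conformalFactor g x.1 p ^ ((n : ℝ) / 4)) :
    orbitPoint g a ha ha0 = x := by
  have h1 : ∀ p, (orbitPoint g a ha ha0).1.field p = x.1.field p := by
    intro p
    have h2 : (orbitPoint g a ha ha0).1.field p = (a p ^ (4 / (n : ℝ))) • g.field p := rfl
    rw [h2, field_eq_conformalFactor_smul hn hg x.2 p, h,
      rpow_div_four_rpow_four_div hn (conformalFactor_pos hn hg x.2 p).le]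
  exact Subtype.ext (Subtype.ext (DFunLike.ext _ _ h1))

variable [CompactSpace M] [MeasurableSpace M] [BorelSpace M]

/-- The length of a polygon with `N + 1` straight sides, inscribed in the segment that is affine in
`ρ ^ (n / 4)`, bounds the distance. The values of `ρ ^ (n / 4)` at the ends of a side have ratio at
most `1 + K / (N + 1)`, where `K` bounds the relative speed of the segment. -/
lemma pathDist_le_polygon (hn : 0 < n) {g : SymTensor n M} (hg : g ∈ riemMetrics n M)
    (x y : conformalOrbit g) : ∃ K : ℝ, 0 ≤ K ∧ ∀ N : ℕ,
      pathDist (conformalOrbit g) x.1 y.1 ≤ √(n : ℝ) *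
        (((1 + K / (N + 1 : ℕ)) ^ (4 / (n : ℝ))) ^ |(n : ℝ) / 4 - 1| *
          ‖orbitLp hn hg y - orbitLp hn hg x‖) := by
  set a : M → ℝ := fun p => conformalFactor g x.1 p ^ ((n : ℝ) / 4) with ha
  set b : M → ℝ := fun p => conformalFactor g y.1 p ^ ((n : ℝ) / 4) with hb
  have hac : ContMDiff (𝓡 n) 𝓘(ℝ, ℝ) ∞ a :=
    contMDiff_rpow_const (contMDiff_conformalFactor hn hg x.2) (conformalFactor_pos hn hg x.2) _
  have hbc : ContMDiff (𝓡 n) 𝓘(ℝ, ℝ) ∞ b :=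
    contMDiff_rpow_const (contMDiff_conformalFactor hn hg y.2) (conformalFactor_pos hn hg y.2) _
  have ha0 : ∀ p, 0 < a p := fun p => Real.rpow_pos_of_pos (conformalFactor_pos hn hg x.2 p) _
  have hb0 : ∀ p, 0 < b p := fun p => Real.rpow_pos_of_pos (conformalFactor_pos hn hg y.2 p) _
  obtain ⟨K, hK0, hKa, hKb⟩ : ∃ K : ℝ, 0 ≤ K ∧ (∀ p, |b p - a p| ≤ K * a p) ∧
      ∀ p, |b p - a p| ≤ K * b p := by
    obtain ⟨K₁, h1⟩ := isCompact_univ.exists_bound_of_continuousOn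
      ((hbc.continuous.sub hac.continuous).div hac.continuous fun p => (ha0 p).ne').continuousOn
    obtain ⟨K₂, h2⟩ := isCompact_univ.exists_bound_of_continuousOn
      ((hbc.continuous.sub hac.continuous).div hbc.continuous fun p => (hb0 p).ne').continuousOn
    refine ⟨max 0 (max K₁ K₂), le_max_left _ _, fun p => ?_, fun p => ?_⟩
    · have h := h1 p (mem_univ p)
      rw [Real.norm_eq_abs, Pi.div_apply, Pi.sub_apply, abs_div, abs_of_pos (ha0 p),
        div_le_iff₀ (ha0 p)] at h
      exact h.trans (mul_le_mul_of_nonneg_right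
        ((le_max_left _ _).trans (le_max_right _ _)) (ha0 p).le)
    · have h := h2 p (mem_univ p)
      rw [Real.norm_eq_abs, Pi.div_apply, Pi.sub_apply, abs_div, abs_of_pos (hb0 p),
        div_le_iff₀ (hb0 p)] at h
      exact h.trans (mul_le_mul_of_nonneg_right
        ((le_max_right _ _).trans (le_max_right _ _)) (hb0 p).le)
  -- the geodesic is affine in `ρ^(n/4)`
  set c : Icc (0 : ℝ) 1 → M → ℝ := fun s p => a p + s * (b p - a p) with hc
  have hcc : ∀ s : Icc (0 : ℝ) 1, ContMDiff (𝓡 n) 𝓘(ℝ, ℝ) ∞ (c s) := fun s =>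
    hac.add (contMDiff_const.mul (hbc.sub hac))
  have hc0 : ∀ (s : Icc (0 : ℝ) 1) (p : M), 0 < c s p := by
    intro s p
    have h : c s p ∈ segment ℝ (a p) (b p) := by
      rw [segment_eq_image']
      exact ⟨s, s.2, rfl⟩
    exact (convex_Ioi (0 : ℝ)).segment_subset (ha0 p) (hb0 p) h
  have hKc : ∀ (s : Icc (0 : ℝ) 1) (p : M), |b p - a p| ≤ K * c s p := by
    intro s p
    have h1 := mul_le_mul_of_nonneg_left (hKa p) (sub_nonneg.2 s.2.2 : (0 : ℝ) ≤ 1 - s)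
    have h2 := mul_le_mul_of_nonneg_left (hKb p) s.2.1
    have h3 : c s p = (1 - s) * a p + s * b p := by simp only [hc]; ring
    rw [h3]
    linarith
  refine ⟨K, hK0, fun N => ?_⟩
  have hN : (0 : ℝ) < (N + 1 : ℕ) := by positivity
  set Q : ℝ := (1 + K / (N + 1 : ℕ)) ^ (4 / (n : ℝ)) with hQ
  set γ : Icc (0 : ℝ) 1 → conformalOrbit g := fun s => orbitPoint g (c s) (hcc s) (hc0 s) with hγ
  have hstep : ∀ s s' : Icc (0 : ℝ) 1, |(s' : ℝ) - s| = 1 / (N + 1 : ℕ) →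
      pathDist (conformalOrbit g) (γ s).1 (γ s').1 ≤ √(n : ℝ) * (Q ^ |(n : ℝ) / 4 - 1| *
        (1 / (N + 1 : ℕ) * ‖orbitLp hn hg y - orbitLp hn hg x‖)) := by
    intro s s' hss
    have hratio : ∀ s s' : Icc (0 : ℝ) 1, |(s' : ℝ) - s| = 1 / (N + 1 : ℕ) → ∀ p,
        conformalFactor g (γ s').1 p ≤ Q * conformalFactor g (γ s).1 p := by
      intro s s' hss p
      rw [conformalFactor_orbitPoint hn hg, conformalFactor_orbitPoint hn hg, hQ,
        ← Real.mul_rpow (by positivity) (hc0 s p).le]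
      refine Real.rpow_le_rpow (hc0 s' p).le ?_ (by positivity)
      have h1 : c s' p = c s p + (s' - s) * (b p - a p) := by simp only [hc]; ring
      have h2 : (s' - s) * (b p - a p) ≤ 1 / (N + 1 : ℕ) * (K * c s p) := by
        refine (le_abs_self _).trans ?_
        rw [abs_mul, hss]
        exact mul_le_mul_of_nonneg_left (hKc s p) (by positivity)
      have h3 : (1 + K / (N + 1 : ℕ)) * c s p = c s p + 1 / (N + 1 : ℕ) * (K * c s p) := by ring
      rw [h1, h3]
      linarith
    have hnorm : ‖orbitLp hn hg (γ s') - orbitLp hn hg (γ s)‖ =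
        1 / (N + 1 : ℕ) * ‖orbitLp hn hg y - orbitLp hn hg x‖ := by
      rw [norm_orbitLp_sub, norm_orbitLp_sub, ← hss, ← Real.sqrt_sq (abs_nonneg _), sq_abs,
        ← Real.sqrt_mul (sq_nonneg _), ← integral_const_mul]
      congr 1
      refine integral_congr_ae (Eventually.of_forall fun p => ?_)
      simp only [hγ]
      rw [orbitCoord_orbitPoint hn hg, orbitCoord_orbitPoint hn hg]
      simp only [orbitCoord, hc, ha, hb]
      ring
    rw [← hnorm]
    exact pathDist_le_of_ratio hn hg (γ s) (γ s') (hratio s s' hss)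
      (hratio s' s (by rw [abs_sub_comm, hss])) (Real.rpow_nonneg (by positivity) _)
  have h0 : γ (projIcc 0 1 zero_le_one 0) = x := by
    refine orbitPoint_eq hn hg x _ _ fun p => ?_
    simp [hc, ha]
  have h1 : γ (projIcc 0 1 zero_le_one 1) = y := by
    refine orbitPoint_eq hn hg y _ _ fun p => ?_
    simp [hc, hb]
  let P : ℕ → ConformalOrbit g := fun k => γ (projIcc 0 1 zero_le_one ((k : ℝ) / (N + 1 : ℕ)))
  have hsum := dist_le_range_sum_of_dist_le (f := P) (N + 1) (d := fun _ =>
    √(n : ℝ) * (Q ^ |(n : ℝ) / 4 - 1| *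
        (1 / (N + 1 : ℕ) * ‖orbitLp hn hg y - orbitLp hn hg x‖))) (fun {k} hk => by
      refine hstep _ _ ?_
      have hk1 : (k : ℝ) / (N + 1 : ℕ) ∈ Icc (0 : ℝ) 1 :=
        ⟨by positivity, (div_le_one hN).2 (by exact_mod_cast hk.le)⟩
      have hk2 : ((k + 1 : ℕ) : ℝ) / (N + 1 : ℕ) ∈ Icc (0 : ℝ) 1 :=
        ⟨by positivity, (div_le_one hN).2 (by exact_mod_cast hk)⟩
      rw [projIcc_of_mem zero_le_one hk1, projIcc_of_mem zero_le_one hk2]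
      have : ((k + 1 : ℕ) : ℝ) / (N + 1 : ℕ) - (k : ℝ) / (N + 1 : ℕ) = 1 / (N + 1 : ℕ) := by
        rw [← sub_div]
        push_cast
        ring
      simp only
      rw [this, abs_of_pos (by positivity)])
  have hP0 : P 0 = x := by
    have : ((0 : ℕ) : ℝ) / (N + 1 : ℕ) = 0 := by simp
    simp only [P, this]
    exact h0
  have hP1 : P (N + 1) = y := by
    have : ((N + 1 : ℕ) : ℝ) / (N + 1 : ℕ) = 1 := div_self hN.ne'
    simp only [P, this]
    exact h1
  rw [hP0, hP1, Finset.sum_const, Finset.card_range, nsmul_eq_mul] at hsum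
  refine hsum.trans_eq ?_
  field_simp

/-- The distance on the conformal orbit is a multiple of the `L²` distance of the coordinates. -/
lemma pathDist_conformalOrbit (hn : 0 < n) {g : SymTensor n M} (hg : g ∈ riemMetrics n M)
    (x y : conformalOrbit g) : pathDist (conformalOrbit g) x.1 y.1 =
      √(n : ℝ) * ‖orbitLp hn hg y - orbitLp hn hg x‖ := by
  refine le_antisymm ?_ ?_
  · obtain ⟨K, hK, h⟩ := pathDist_le_polygon hn hg x y
    have h1 : Tendsto (fun N : ℕ => 1 + K / (N + 1 : ℕ)) atTop (𝓝 (1 + 0)) :=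
      tendsto_const_nhds.add
        ((tendsto_const_div_atTop_nhds_zero_nat K).comp (tendsto_add_atTop_nat 1))
    rw [add_zero] at h1
    have h2 := ((h1.rpow_const (p := 4 / (n : ℝ)) (Or.inl one_ne_zero)).rpow_const
      (p := |(n : ℝ) / 4 - 1|) (Or.inr (abs_nonneg _)))
    have h3 := (h2.mul_const ‖orbitLp hn hg y - orbitLp hn hg x‖).const_mul √(n : ℝ)
    rw [Real.one_rpow, Real.one_rpow, one_mul] at h3
    exact ge_of_tendsto' h3 h
  · have : Nonempty (PiecewiseC1Path (conformalOrbit g) x.1 y.1) :=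
      ⟨.single (C1Path.segment (convex_conformalOrbit g) x.2 y.2)⟩
    exact le_ciInf fun α => α.norm_orbitLp_sub_le hn hg x.2 y.2

end geodesics

/-! ### The completion of the orbit -/

section completion

/-- A map into a closed subset of a Banach space with dense image that scales all distances by the
same constant identifies the completion with that subset. -/
lemma exists_completion_bijOn {X E : Type*} [PseudoMetricSpace X] [NormedAddCommGroup E]
    [NormedSpace ℝ E] [CompleteSpace E] {J : X → E} {c : ℝ} (hc : 0 < c)
    (hJ : ∀ x y, dist x y = c * ‖J y - J x‖) {S : Set E} (hS : IsClosed S)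
    (hJS : ∀ x, J x ∈ S) (hSJ : S ⊆ closure (range J)) :
    ∃ F : UniformSpace.Completion X → E, BijOn F univ S ∧ (∀ x : X, F x = J x) ∧
      ∀ p q, dist p q = c * ‖F q - F p‖ := by
  have hiso : Isometry fun x => c • J x := by
    refine Isometry.of_dist_eq fun x y => ?_
    rw [hJ, dist_eq_norm, ← smul_sub, norm_smul, Real.norm_of_nonneg hc.le, norm_sub_rev]
  have hG : Isometry (UniformSpace.Completion.extension fun x => c • J x) :=
    hiso.completion_extension
  set G := UniformSpace.Completion.extension fun x => c • J x with hGdef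
  have hGx : ∀ x : X, G x = c • J x := fun x =>
    UniformSpace.Completion.extension_coe hiso.uniformContinuous x
  have hF : Continuous fun p => c⁻¹ • G p := hG.continuous.const_smul _
  have hFx : ∀ x : X, c⁻¹ • G x = J x := fun x => by
    rw [hGx, smul_smul, inv_mul_cancel₀ hc.ne', one_smul]
  have hdist : ∀ p q, dist p q = c * ‖c⁻¹ • G q - c⁻¹ • G p‖ := by
    intro p q
    rw [← smul_sub, norm_smul, Real.norm_of_nonneg (inv_nonneg.2 hc.le),
      mul_inv_cancel_left₀ hc.ne', ← dist_eq_norm, hG.dist_eq, dist_comm]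
  refine ⟨fun p => c⁻¹ • G p, ⟨fun p _ => ?_, fun p _ q _ hpq => ?_, fun z hz => ?_⟩, hFx, hdist⟩
  · exact UniformSpace.Completion.induction_on p (hS.preimage hF) fun x => by
      show c⁻¹ • G x ∈ S
      exact (hFx x).symm ▸ hJS x
  · rw [← dist_eq_zero, hdist p q]
    simp only at hpq
    rw [hpq, sub_self, norm_zero, mul_zero]
  · have hcl : IsClosed (range G) := hG.isClosedEmbedding.isClosed_range
    have hcl' : IsClosed (range fun p => c⁻¹ • G p) := by
      have : (range fun p => c⁻¹ • G p) = (fun v : E => c • v) ⁻¹' range G := by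
        ext v
        constructor
        · rintro ⟨p, rfl⟩
          exact ⟨p, by simp [smul_smul, mul_inv_cancel₀ hc.ne']⟩
        · rintro ⟨p, hp⟩
          exact ⟨p, by simp [hp, smul_smul, inv_mul_cancel₀ hc.ne']⟩
      rw [this]
      exact hcl.preimage (continuous_const_smul c)
    have hsub : range J ⊆ range fun p => c⁻¹ • G p := by
      rintro _ ⟨x, rfl⟩
      exact ⟨x, hFx x⟩
    obtain ⟨p, hp⟩ := closure_minimal hsub hcl' (hSJ hz)
    exact ⟨p, mem_univ p, hp⟩

/-- The closed half-space `{f ≥ c}` of `L²` is the closure of the continuous functions in it. -/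
lemma Lp.exists_continuous_ge_norm_sub_lt {X : Type*} [TopologicalSpace X] [CompactSpace X]
    [NormalSpace X] [MeasurableSpace X] [BorelSpace X] {μ : Measure X} [IsFiniteMeasure μ]
    [μ.WeaklyRegular] (f : Lp ℝ 2 μ) {c : ℝ} (hf : ∀ᵐ x ∂μ, c ≤ f x) {ε : ℝ} (hε : 0 < ε) :
    ∃ k : X → ℝ, ∃ hk : Continuous k, (∀ x, c ≤ k x) ∧
      ‖(memLp_of_continuous hk 2).toLp k - f‖ ≤ ε := by
  obtain ⟨k, hk1, hk2⟩ := (Lp.memLp f).exists_boundedContinuous_eLpNorm_sub_le (by simp)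
    (ENNReal.ofReal_pos.2 hε).ne'
  -- since `f = max f c` almost everywhere, truncating `k` at `c` does not increase `|k - f|`
  have hkc : Continuous fun x => max (k x) c := k.continuous.max continuous_const
  refine ⟨fun x => max (k x) c, hkc, fun x => le_max_right _ _, ?_⟩
  have h1 : ‖hk2.toLp k - f‖ ≤ ε := by
    rw [norm_sub_rev, Lp.norm_def]
    refine ENNReal.toReal_le_of_le_ofReal hε.le (le_trans (le_of_eq (eLpNorm_congr_ae ?_)) hk1)
    filter_upwards [Lp.coeFn_sub f (hk2.toLp k), hk2.coeFn_toLp] with x h2 h3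
    rw [h2, Pi.sub_apply, h3, Pi.sub_apply]
  refine le_trans (Lp.norm_le_norm_of_ae_le ?_) h1
  filter_upwards [Lp.coeFn_sub ((memLp_of_continuous hkc 2).toLp _) f, Lp.coeFn_sub (hk2.toLp k) f,
    hk2.coeFn_toLp, (memLp_of_continuous hkc 2).coeFn_toLp, hf] with x h2 h3 h4 h5 h6
  rw [h2, h3, Pi.sub_apply, Pi.sub_apply, h4, h5, Real.norm_eq_abs, Real.norm_eq_abs]
  have h7 : f x = max (f x) c := (max_eq_left h6).symm
  conv_lhs => rw [h7]
  exact abs_max_sub_max_le_abs _ _ _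

variable {n : ℕ} {M : Type*} [TopologicalSpace M]
  [ChartedSpace (EuclideanSpace ℝ (Fin n)) M] [IsManifold (𝓡 n) ∞ M] [MeasurableSpace M]

lemma isClosed_expDomain [CompactSpace M] [BorelSpace M] (g : SymTensor n M) :
    IsClosed (expDomain g) := by
  have := isFiniteMeasure_volMeasure g
  have hm : MemLp (fun _ : M => -(4 / (n : ℝ))) 2 (volMeasure g.field) := memLp_const _
  have : expDomain g = Ici (hm.toLp _) := by
    ext lam
    rw [mem_Ici, ← Lp.coeFn_le]
    constructor
    · intro h
      filter_upwards [h, hm.coeFn_toLp] with x h1 h2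
      rwa [h2]
    · intro h
      filter_upwards [h, hm.coeFn_toLp] with x h1 h2
      rwa [h2] at h1
  rw [this]
  exact isClosed_Ici

variable [CompactSpace M] [BorelSpace M]

lemma orbitLp_ae (hn : 0 < n) {g : SymTensor n M} (hg : g ∈ riemMetrics n M)
    (x : conformalOrbit g) : ∀ᵐ p ∂(volMeasure g.field), orbitLp hn hg x p =
      4 / (n : ℝ) * (conformalFactor g x.1 p ^ ((n : ℝ) / 4) - 1) :=
  (memLp_orbitCoord hn hg x.2).coeFn_toLp

lemma orbitLp_mem_expDomain (hn : 0 < n) {g : SymTensor n M} (hg : g ∈ riemMetrics n M)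
    (x : conformalOrbit g) : orbitLp hn hg x ∈ expDomain g ∧
      expChart g (orbitLp hn hg x) = AETensorField.mk g x.1.field := by
  have h := expChart_eq_of_ae hn
    (Eventually.of_forall fun p => (conformalFactor_pos hn hg x.2 p).le) (orbitLp_ae hn hg x)
  have h1 : conf (conformalFactor g x.1) g = x.1.field :=
    funext fun p => (field_eq_conformalFactor_smul hn hg x.2 p).symm
  rwa [h1] at h

/-- The coordinates of the smooth metrics `ρ g` are dense in the domain of the exponential chart. -/
lemma expDomain_subset_closure [T2Space M] (hn : 0 < n) {g : SymTensor n M}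
    (hg : g ∈ riemMetrics n M) : expDomain g ⊆ closure (range (orbitLp hn hg)) := by
  have hfin := isFiniteMeasure_volMeasure g
  have hsc : SecondCountableTopology M :=
    ChartedSpace.secondCountable_of_sigmaCompact (EuclideanSpace ℝ (Fin n)) M
  have h0 : (0 : ℝ) < n := by exact_mod_cast hn
  intro lam hlam
  refine Metric.mem_closure_iff.2 fun ε hε => ?_
  obtain ⟨k, hkc, hk, hkε⟩ := Lp.exists_continuous_ge_norm_sub_lt lam hlam (half_pos hε)
  -- `δ` makes the uniform distance `2 δ` an `L²` distance less than `ε / 2`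
  set V := √((volMeasure g.field).real univ) with hV
  have hV0 : 0 ≤ V := Real.sqrt_nonneg _
  set δ := ε / (4 * (V + 1)) with hδ
  have hδ0 : 0 < δ := by positivity
  -- the shift by `δ` keeps the smooth approximation strictly above `-4 / n`
  obtain ⟨f, hf, -⟩ := Continuous.exists_contMDiff_approx (𝓡 n) (F := ℝ) (⊤ : ℕ∞)
    (hkc.add (continuous_const (y := δ))) (continuous_const (y := δ)) (fun _ => hδ0)
  have hfk : ∀ p, -(4 / (n : ℝ)) < f p ∧ |f p - k p| ≤ 2 * δ := by
    intro p
    have h1 : dist (f p) (k p + δ) < δ := hf p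
    rw [Real.dist_eq, abs_lt] at h1
    have h2 := hk p
    exact ⟨by linarith, abs_le.2 ⟨by linarith, by linarith⟩⟩
  have ha : ContMDiff (𝓡 n) 𝓘(ℝ, ℝ) ∞ fun p => 1 + (n : ℝ) / 4 * f p :=
    contMDiff_const.add (contMDiff_const.mul f.contMDiff)
  have ha0 : ∀ p, 0 < 1 + (n : ℝ) / 4 * f p := by
    intro p
    have h1 : (n : ℝ) / 4 * -(4 / n) = -1 := by field_simp
    have h2 := mul_lt_mul_of_pos_left (hfk p).1 (show 0 < (n : ℝ) / 4 by positivity)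
    linarith
  refine ⟨_, ⟨orbitPoint g _ ha ha0, rfl⟩, ?_⟩
  have hcoord : ∀ p, orbitCoord g (orbitPoint g _ ha ha0).1 p = f p := by
    intro p
    rw [orbitCoord_orbitPoint hn hg]
    field_simp
    ring
  have h1 : ‖orbitLp hn hg (orbitPoint g _ ha ha0) - (memLp_of_continuous hkc 2).toLp k‖ ≤
      2 * δ * V := by
    rw [orbitLp, ← MemLp.toLp_sub, norm_toLp_two, hV, ← Real.sqrt_sq (by positivity : 0 ≤ 2 * δ),
      ← Real.sqrt_mul (sq_nonneg _)]
    refine Real.sqrt_le_sqrt ?_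
    have h2 : ∀ p, (orbitCoord g (orbitPoint g _ ha ha0).1 - k) p ^ 2 ≤ (2 * δ) ^ 2 := by
      intro p
      rw [Pi.sub_apply, hcoord]
      exact sq_le_sq.2 ((hfk p).2.trans (le_abs_self _))
    refine (integral_mono_of_nonneg (Eventually.of_forall fun p => sq_nonneg _)
      (integrable_const _) (Eventually.of_forall h2)).trans_eq ?_
    rw [integral_const, smul_eq_mul, mul_comm]
  have h2 : 2 * δ * V < ε / 2 := by
    rw [hδ]
    have : 2 * (ε / (4 * (V + 1))) * V = ε / 2 * (V / (V + 1)) := by field_simp; ring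
    rw [this]
    have h3 : V / (V + 1) < 1 := (div_lt_one (by positivity)).2 (by linarith)
    have h4 := mul_lt_mul_of_pos_left h3 (half_pos hε)
    linarith
  rw [dist_comm, dist_eq_norm]
  have h3 := norm_sub_le_norm_sub_add_norm_sub (orbitLp hn hg (orbitPoint g _ ha ha0))
    ((memLp_of_continuous hkc 2).toLp k) lam
  linarith

/-- The completion of a space isometric to the conformal orbit of `g`. The space `X` is kept
separate from the orbit, as in dimension one it is the space of all metrics. -/
lemma exists_completion_map [T2Space M] (hn : 0 < n) {g : SymTensor n M}
    (hg : g ∈ riemMetrics n M) {X : Type*} [PseudoMetricSpace X] (ι : X → conformalOrbit g)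
    (hι : Function.Surjective ι)
    (hdist : ∀ x y, dist x y = pathDist (conformalOrbit g) (ι x).1 (ι y).1) :
    ∃ Φ : UniformSpace.Completion X → AETensorField g,
      BijOn Φ univ (finiteVolumeConformal g) ∧
      (∀ x : X, Φ x = AETensorField.mk g (ι x).1.field) ∧
      ∀ p q, ∀ lam₁ ∈ expDomain g, ∀ lam₂ ∈ expDomain g,
        Φ p = expChart g lam₁ → Φ q = expChart g lam₂ →
          dist p q = √(n : ℝ) * ‖lam₂ - lam₁‖ := by
  have hc : 0 < √(n : ℝ) := Real.sqrt_pos.2 (by exact_mod_cast hn)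
  have hcl : expDomain g ⊆ closure (range fun x => orbitLp hn hg (ι x)) := by
    rw [show (range fun x => orbitLp hn hg (ι x)) = range (orbitLp hn hg) from
      hι.range_comp (orbitLp hn hg)]
    exact expDomain_subset_closure hn hg
  obtain ⟨F, hF, hFx, hFd⟩ := exists_completion_bijOn (J := fun x => orbitLp hn hg (ι x)) hc
    (fun x y => (hdist x y).trans (pathDist_conformalOrbit hn hg _ _)) (isClosed_expDomain g)
    (fun x => (orbitLp_mem_expDomain hn hg (ι x)).1) hcl
  refine ⟨fun p => expChart g (F p), (bijOn_expChart hn hg).comp hF, fun x => ?_, ?_⟩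
  · simp only [hFx]
    exact (orbitLp_mem_expDomain hn hg (ι x)).2
  · intro p q lam₁ h1 lam₂ h2 hp hq
    have hp' := injOn_expChart hn hg (hF.1 (mem_univ p)) h1 hp
    have hq' := injOn_expChart hn hg (hF.1 (mem_univ q)) h2 hq
    rw [hFd, hp', hq']

end completion

/-! ### Dimension one -/

section dimensionOne
variable {M : Type*} [TopologicalSpace M]
  [ChartedSpace (EuclideanSpace ℝ (Fin 1)) M] [IsManifold (𝓡 1) ∞ M]

/-- In dimension one all metrics are conformal to each other. -/
lemma riemMetrics_one_eq_conformalOrbit {g : SymTensor 1 M} (hg : g ∈ riemMetrics 1 M) :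
    riemMetrics 1 M = conformalOrbit g := by
  ext h
  constructor
  · intro hh
    have hfac : ∀ e ∈ atlas (EuclideanSpace ℝ (Fin 1)) M, ∀ u ∈ e.target,
        h.field (e.symm u) =
          (coeff e h.field 0 0 u / coeff e g.field 0 0 u) • g.field (e.symm u) := by
      intro e he u hu
      refine ContinuousLinearMap.ext fun v => ContinuousLinearMap.ext fun w => ?_
      obtain ⟨c, d, hcd⟩ := form_apply_eq_sum_coeff he hu v w
      show h.field (e.symm u) v w =
        (coeff e h.field 0 0 u / coeff e g.field 0 0 u) * g.field (e.symm u) v w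
      have h0 := (coeff_self_pos hg he hu 0).ne'
      rw [hcd, hcd]
      simp only [Finset.univ_unique, Fin.default_eq_zero, Finset.sum_singleton]
      field_simp
    have hcf : ∀ e ∈ atlas (EuclideanSpace ℝ (Fin 1)) M, ∀ u ∈ e.target,
        conformalFactor g h (e.symm u) = coeff e h.field 0 0 u / coeff e g.field 0 0 u :=
      fun e he u hu => conformalFactor_eq one_pos hg (hfac e he u hu)
    have hchart : ∀ x : M, (chartAt (EuclideanSpace ℝ (Fin 1)) x).symm
        (chartAt (EuclideanSpace ℝ (Fin 1)) x x) = x :=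
      fun x => (chartAt _ x).left_inv (mem_chart_source _ x)
    have hmem : ∀ x : M, chartAt (EuclideanSpace ℝ (Fin 1)) x x ∈
        (chartAt (EuclideanSpace ℝ (Fin 1)) x).target :=
      fun x => (chartAt _ x).map_source (mem_chart_source _ x)
    refine ⟨conformalFactor g h, fun x => ?_, fun x => ?_, fun x => ?_⟩
    · set e := chartAt (EuclideanSpace ℝ (Fin 1)) x with he
      have hea : e ∈ atlas (EuclideanSpace ℝ (Fin 1)) M := chart_mem_atlas _ x
      have h1 : ContDiffOn ℝ ∞ (fun u => coeff e h.field 0 0 u / coeff e g.field 0 0 u) e.target :=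
        (contDiffOn_coeff hea h 0 0).div (contDiffOn_coeff hea g 0 0)
          fun u hu => (coeff_self_pos hg hea hu 0).ne'
      have h2 : ContDiffAt ℝ ∞ (fun u => coeff e h.field 0 0 u / coeff e g.field 0 0 u) (e x) :=
        h1.contDiffAt (e.open_target.mem_nhds (hmem x))
      have h3 : ContMDiffAt (𝓡 1) (𝓡 1) ∞ e x :=
        contMDiffAt_of_mem_maximalAtlas (IsManifold.subset_maximalAtlas hea)
          (mem_chart_source _ x)
      refine (h2.comp_contMDiffAt h3).congr_of_eventuallyEq ?_
      filter_upwards [e.open_source.mem_nhds (mem_chart_source _ x)] with y hy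
      have h4 := hcf e hea (e y) (e.map_source hy)
      rw [e.left_inv hy] at h4
      exact h4
    · have h4 := hcf _ (chart_mem_atlas _ x) _ (hmem x)
      rw [hchart x] at h4
      rw [h4]
      exact div_pos (coeff_self_pos hh (chart_mem_atlas _ x) (hmem x) 0)
        (coeff_self_pos hg (chart_mem_atlas _ x) (hmem x) 0)
    · obtain ⟨e, he, u, hu, rfl⟩ : ∃ e ∈ atlas (EuclideanSpace ℝ (Fin 1)) M, ∃ u ∈ e.target,
          e.symm u = x := ⟨_, chart_mem_atlas _ x, _, hmem x, hchart x⟩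
      rw [hcf e he u hu]
      exact hfac e he u hu
  · rintro ⟨ρ, -, hρ, hh⟩ x v hv
    have h1 : h.field x v v = ρ x * g.field x v v := by rw [hh]; rfl
    rw [h1]
    exact mul_pos (hρ x) (hg x v hv)

variable [MeasurableSpace M]

lemma integrableConformal_one (g : SymTensor 1 M) : integrableConformal g =
    {T | ∃ ρ : M → ℝ, AEMeasurable ρ (volMeasure g.field) ∧
      (∀ᵐ x ∂(volMeasure g.field), 0 ≤ ρ x) ∧
      Integrable (fun x => √(ρ x)) (volMeasure g.field) ∧
      T = AETensorField.mk g (conf ρ g)} := by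
  ext T
  refine exists_congr fun ρ => and_congr_right fun h1 => and_congr_right fun h2 =>
    and_congr_left fun _ => ?_
  have h3 : ∀ x, ρ x ^ (((1 : ℕ) : ℝ) / 2) = √(ρ x) := fun x => by
    rw [Real.sqrt_eq_rpow, Nat.cast_one]
  simp only [h3]
  rw [lt_top_iff_ne_top]
  exact lintegral_ofReal_ne_top_iff_integrable
    (Real.continuous_sqrt.measurable.comp_aemeasurable h1).aestronglyMeasurable
    (Eventually.of_forall fun x => Real.sqrt_nonneg _)

end dimensionOne

end

theorem mainTheorem7 {n : ℕ} (hn : 0 < n) {M : Type*} [TopologicalSpace M] [T2Space M]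
    [CompactSpace M] [ChartedSpace (EuclideanSpace ℝ (Fin n)) M] [IsManifold (𝓡 n) ∞ M]
    [MeasurableSpace M] [BorelSpace M] (g : SymTensor n M) (hg : g ∈ riemMetrics n M) :
    -- finite volume of `ρ g` means `ρ ∈ L^(n/2)`
    (∀ ρ : M → ℝ, AEMeasurable ρ (volMeasure g.field) →
      (∀ᵐ x ∂(volMeasure g.field), 0 ≤ ρ x) →
      volMeasure (conf ρ g) univ =
        ∫⁻ x, ENNReal.ofReal (ρ x ^ ((n : ℝ) / 2)) ∂(volMeasure g.field)) ∧
    finiteVolumeConformal g = integrableConformal g ∧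
    -- the exponential chart is a bijection from its (closed) domain onto the set of these `ρ g`
    BijOn (expChart g) (expDomain g) (finiteVolumeConformal g) ∧
    -- the completion of the conformal orbit
    (∃ Φ : UniformSpace.Completion (ConformalOrbit g) → AETensorField g,
      BijOn Φ univ (finiteVolumeConformal g) ∧
      (∀ h : ConformalOrbit g, Φ h = AETensorField.mk g (SymTensor.field h.1)) ∧
      ∀ (p q : UniformSpace.Completion (ConformalOrbit g)),
        ∀ lam₁ ∈ expDomain g, ∀ lam₂ ∈ expDomain g,
          Φ p = expChart g lam₁ → Φ q = expChart g lam₂ →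
            dist p q = √(n : ℝ) * ‖lam₂ - lam₁‖) ∧
    -- in dimension one, the completion of the space of all metrics
    (n = 1 →
      ∃ Φ : UniformSpace.Completion (MetricManifold n M) → AETensorField g,
        BijOn Φ univ {T | ∃ ρ : M → ℝ, AEMeasurable ρ (volMeasure g.field) ∧
          (∀ᵐ x ∂(volMeasure g.field), 0 ≤ ρ x) ∧
          Integrable (fun x => √(ρ x)) (volMeasure g.field) ∧
          T = AETensorField.mk g (conf ρ g)} ∧
        (∀ h : MetricManifold n M, Φ h = AETensorField.mk g (SymTensor.field h.1)) ∧
        ∀ (p q : UniformSpace.Completion (MetricManifold n M)),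
          ∀ lam₁ ∈ expDomain g, ∀ lam₂ ∈ expDomain g,
            Φ p = expChart g lam₁ → Φ q = expChart g lam₂ →
              dist p q = ‖lam₂ - lam₁‖) := by
  refine ⟨fun ρ h1 h2 => volMeasure_conf_univ hg h1 h2, finiteVolumeConformal_eq hg,
    bijOn_expChart hn hg, ?_, ?_⟩
  · exact exists_completion_map hn hg (X := ConformalOrbit g) (fun x => x)
      Function.surjective_id fun x y => rfl
  · rintro rfl
    have heq := riemMetrics_one_eq_conformalOrbit hg
    obtain ⟨Φ, h1, h2, h3⟩ := exists_completion_map hn hg (X := MetricManifold 1 M)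
      (fun x => ⟨x.1, heq ▸ x.2⟩) (fun y => ⟨⟨y.1, heq.symm ▸ y.2⟩, rfl⟩)
      (fun x y => congrArg (fun N => pathDist N x.1 y.1) heq)
    rw [finiteVolumeConformal_eq hg, integrableConformal_one] at h1
    refine ⟨Φ, h1, h2, fun p q lam₁ hl₁ lam₂ hl₂ hp hq => ?_⟩
    rw [h3 p q lam₁ hl₁ lam₂ hl₂ hp hq, Nat.cast_one, Real.sqrt_one, one_mul]
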